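/- Let $\ell\in\mathbb N$ be such that $-\ell$ is a fundamental discriminant (either $\ell\equiv 3 \pmod 4$ is square-free, or $\ell=4m$ with $m\equiv 1,2\pmod 4$ square-free), let $L=\mathbb Q(\sqrt{-\ell})\subset\mathbb C$ and let $O_L$ be its ring of integers. Let $(V,h)$ be a positive definite Hermitian space over $L$ of finite dimension $d$, and let $\Lambda\subset V$ be an $O_L$-lattice (a finitely generated $O_L$-submodule spanning $V$, not necessarily free) such that $$\Lambda^*:=\{v\in V\mid h(v,\Lambda)\subset O_L\}=\sqrt{-\ell}\,\Lambda .$$ Let $n\ge 1$, let $\mathcal H_n=\{Z\in\mathbb C^{n\times n}\mid \tfrac1{2i}(Z-\overline Z^{t})>0\}$ be the Hermitian half space, and put $$\theta(Z)=\sum_{(x_1,\dots,x_n)\in\Lambda^n}\exp\bigl(2\pi i\,\mathrm{trace}\bigl((h(x_i,x_j))_{i,j}\,Z\bigr)\bigr)\qquad(Z\in\mathcal H_n),$$ where $\mathrm{trace}$ is the matrix trace. Then the series converges absolutely on $\mathcal H_n$, and $$\theta(-Z^{-1})=\det(Z/i)^d\,\theta(Z)\qquad(Z\in\mathcal H_n).$$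 Suppose in addition, if $4\mid \ell$, that $h(x,x)\in\mathbb Z$ for all $x\in\Lambda$, i.e. that $\Lambda$ is an even $\mathbb Z$-lattice for $\mathrm{Tr}_{L/\mathbb Q}\circ h$ (for odd $\ell$ nothing is assumed). Then $4\mid d$, and $\theta$ is a Hermitian modular form of weight $d$ for the full modular group $$\Gamma_n=\Bigl\langle \begin{pmatrix} I_n&B\\0&I_n\end{pmatrix},\ \begin{pmatrix}\overline U^{t}&0\\0&U^{-1}\end{pmatrix},\ \begin{pmatrix}0&-I_n\\I_n&0\end{pmatrix}\ \Big|\ B\in O_L^{n\times n}\text{ Hermitian},\ U\in \mathrm{GL}_n(O_L)\Bigr\rangle .$$ That is, $\theta$ is holomorphic on $\mathcal H_n$; it is bounded on $\{Z\mid \tfrac1{2i}(Z-\overline Z^{t})\ge Y_0\}$ for every positive definite Hermitian $Y_0$; and $$\theta\bigl((AZ+B)(CZ+D)^{-1}\bigr)=\det(M)^{-d/2}\det(CZ+D)^d\,\theta(Z)\qquad\text{for all } M=\begin{pmatrix}A&B\\C&D\end{pmatrix}\in\Gamma_n,\ Z\in\mathcal H_n .$$ If $\ell\ne 3$, the factor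 $\det(M)^{-d/2}$ can be omitted: $\theta((AZ+B)(CZ+D)^{-1})=\det(CZ+D)^d\,\theta(Z)$ for all such $M$ and $Z$. -/

import Mathlib

open Matrix NumberField
open scoped ComplexOrder

noncomputable section

namespace HermTheta

/-- `-ℓ` is a (negative) fundamental discriminant. -/
def IsNegFundamentalDiscriminant (ℓ : ℕ) : Prop :=
  (ℓ % 4 = 3 ∧ Squarefree ℓ) ∨
    ∃ m : ℕ, ℓ = 4 * m ∧ (m % 4 = 1 ∨ m % 4 = 2) ∧ Squarefree m

/-- The complex number `√(-ℓ) = i √ℓ`. -/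
def sqrtNegC (ℓ : ℕ) : ℂ := Complex.I * (Real.sqrt ℓ : ℂ)

/-- The field `L = ℚ(√(-ℓ))`, as a subfield of `ℂ`. Its ring of integers `O_L` is `𝓞 (L ℓ)`. -/
abbrev L (ℓ : ℕ) : IntermediateField ℚ ℂ := IntermediateField.adjoin ℚ {sqrtNegC ℓ}

/-- The element `√(-ℓ)` of `L`. -/
def sqrtNeg (ℓ : ℕ) : L ℓ :=
  ⟨sqrtNegC ℓ, IntermediateField.mem_adjoin_simple_self ℚ (sqrtNegC ℓ)⟩

theorem conj_mem_L (ℓ : ℕ) {z : ℂ} (hz : z ∈ L ℓ) : starRingEnd ℂ z ∈ L ℓ := by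
  have key : L ℓ ≤ (L ℓ).comap (Complex.conjAe.toAlgHom.restrictScalars ℚ) := by
    rw [IntermediateField.adjoin_simple_le_iff]
    change starRingEnd ℂ (sqrtNegC ℓ) ∈ L ℓ
    have : starRingEnd ℂ (sqrtNegC ℓ) = -sqrtNegC ℓ := by simp [sqrtNegC]
    rw [this]
    exact neg_mem (IntermediateField.mem_adjoin_simple_self ℚ (sqrtNegC ℓ))
  exact key hz

/-- Complex conjugation on `L`. -/
def conjL (ℓ : ℕ) : L ℓ →+* L ℓ :=
  ((starRingEnd ℂ).comp (L ℓ).val.toRingHom).codRestrict (L ℓ)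
    (fun x => conj_mem_L ℓ x.2)

/-- A form `h`, linear in the first and conjugate-linear in the second variable, is a
positive definite Hermitian form. -/
structure IsPosDefHermitian {ℓ : ℕ} {V : Type*} [AddCommGroup V] [Module (L ℓ) V]
    (h : V →ₗ[L ℓ] V →ₛₗ[conjL ℓ] L ℓ) : Prop where
  conj_symm : ∀ x y : V, h y x = conjL ℓ (h x y)
  pos : ∀ x : V, x ≠ 0 → 0 < ((h x x : L ℓ) : ℂ)

/-- The `O_L`-dual `{v ∈ V | h(v, Λ) ⊆ O_L}` of an `O_L`-submodule `Λ` of `V`. -/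
def hermDual {ℓ : ℕ} {V : Type*} [AddCommGroup V] [Module (L ℓ) V] [Module (𝓞 (L ℓ)) V]
    (h : V →ₗ[L ℓ] V →ₛₗ[conjL ℓ] L ℓ) (Λ : Submodule (𝓞 (L ℓ)) V) : Set V :=
  {v | ∀ x ∈ Λ, ∃ a : 𝓞 (L ℓ), h v x = algebraMap (𝓞 (L ℓ)) (L ℓ) a}

/-- The imaginary part `(Z - Zᴴ) / (2 i)` of a complex square matrix, a Hermitian matrix. -/
def imPart {n : ℕ} (Z : Matrix (Fin n) (Fin n) ℂ) : Matrix (Fin n) (Fin n) ℂ :=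
  (2 * Complex.I)⁻¹ • (Z - Zᴴ)

/-- The Hermitian half space of degree `n`. -/
def halfSpace (n : ℕ) : Set (Matrix (Fin n) (Fin n) ℂ) := {Z | (imPart Z).PosDef}

/-- The Gram matrix `(h(x_i, x_j))`, as a complex matrix. -/
def gram {ℓ : ℕ} {V : Type*} [AddCommGroup V] [Module (L ℓ) V]
    (h : V →ₗ[L ℓ] V →ₛₗ[conjL ℓ] L ℓ) {n : ℕ} (x : Fin n → V) :
    Matrix (Fin n) (Fin n) ℂ :=
  Matrix.of fun i j => ((h (x i) (x j) : L ℓ) : ℂ)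

/-- The term `exp(2πi trace((h(x_i, x_j)) Z))` of the theta series. -/
def thetaTerm {ℓ : ℕ} {V : Type*} [AddCommGroup V] [Module (L ℓ) V]
    (h : V →ₗ[L ℓ] V →ₛₗ[conjL ℓ] L ℓ) {n : ℕ} (Z : Matrix (Fin n) (Fin n) ℂ)
    (x : Fin n → V) : ℂ :=
  Complex.exp (2 * (Real.pi : ℂ) * Complex.I * (gram h x * Z).trace)

/-- The Hermitian theta series of genus `n` of `Λ`. -/
def theta {ℓ : ℕ} {V : Type*} [AddCommGroup V] [Module (L ℓ) V] [Module (𝓞 (L ℓ)) V]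
    (h : V →ₗ[L ℓ] V →ₛₗ[conjL ℓ] L ℓ) (Λ : Submodule (𝓞 (L ℓ)) V) (n : ℕ)
    (Z : Matrix (Fin n) (Fin n) ℂ) : ℂ :=
  ∑' x : Fin n → Λ, thetaTerm h Z (fun i => (x i : V))

/-- The complex matrix underlying a matrix with entries in `O_L`. -/
def toC {ℓ n : ℕ} (A : Matrix (Fin n) (Fin n) (𝓞 (L ℓ))) : Matrix (Fin n) (Fin n) ℂ :=
  A.map (algebraMap (𝓞 (L ℓ)) ℂ)

/-- The full modular group `Γ_n`, generated by the translations by Hermitian matrices `B` over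
`O_L`, by the matrices `diag(Uᴴ, U⁻¹)` with `U ∈ GL_n(O_L)`, and by the inversion. -/
def fullModularGroup (ℓ n : ℕ) : Subgroup (GL (Fin n ⊕ Fin n) ℂ) :=
  Subgroup.closure
    ({M | ∃ B : Matrix (Fin n) (Fin n) (𝓞 (L ℓ)), (toC B).IsHermitian ∧
        (M : Matrix (Fin n ⊕ Fin n) (Fin n ⊕ Fin n) ℂ) = fromBlocks 1 (toC B) 0 1} ∪
     {M | ∃ U : GL (Fin n) (𝓞 (L ℓ)),
        (M : Matrix (Fin n ⊕ Fin n) (Fin n ⊕ Fin n) ℂ) =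
          fromBlocks (toC (U : Matrix (Fin n) (Fin n) (𝓞 (L ℓ))))ᴴ 0 0
            (toC ((U⁻¹ : GL (Fin n) (𝓞 (L ℓ))) : Matrix (Fin n) (Fin n) (𝓞 (L ℓ))))} ∪
     {M | (M : Matrix (Fin n ⊕ Fin n) (Fin n ⊕ Fin n) ℂ) = fromBlocks 0 (-1) 1 0})

/-- The lower row `C Z + D` of `M = (A, B; C, D)` at `Z`. -/
def denom {n : ℕ} (M : GL (Fin n ⊕ Fin n) ℂ) (Z : Matrix (Fin n) (Fin n) ℂ) :
    Matrix (Fin n) (Fin n) ℂ :=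
  (M : Matrix (Fin n ⊕ Fin n) (Fin n ⊕ Fin n) ℂ).toBlocks₂₁ * Z +
    (M : Matrix (Fin n ⊕ Fin n) (Fin n ⊕ Fin n) ℂ).toBlocks₂₂

/-- The action `M⟨Z⟩ = (A Z + B) (C Z + D)⁻¹`. -/
def act {n : ℕ} (M : GL (Fin n ⊕ Fin n) ℂ) (Z : Matrix (Fin n) (Fin n) ℂ) :
    Matrix (Fin n) (Fin n) ℂ :=
  ((M : Matrix (Fin n ⊕ Fin n) (Fin n ⊕ Fin n) ℂ).toBlocks₁₁ * Z +
    (M : Matrix (Fin n ⊕ Fin n) (Fin n ⊕ Fin n) ℂ).toBlocks₁₂) * (denom M Z)⁻¹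

/-- `f` is a Hermitian modular form of weight `2 r` and genus `n` for the full modular group
`Γ_n` over `ℚ(√(-ℓ))`: it is holomorphic on the half space, satisfies
`f(M⟨Z⟩) = det(M)^(-r) det(CZ + D)^(2r) f(Z)` for `M ∈ Γ_n`, and is bounded on each
set `{Z | Im Z ≥ Y₀}` with `Y₀` positive definite. On the elements of `Γ_n` of determinant one
the automorphy factor is the usual one, `det(CZ + D)^(2r)`. -/
structure IsHermitianModularForm (ℓ n r : ℕ) (f : Matrix (Fin n) (Fin n) ℂ → ℂ) : Prop where
  holomorphic : DifferentiableOn ℂ f (halfSpace n)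
  transform : ∀ M ∈ fullModularGroup ℓ n, ∀ Z ∈ halfSpace n,
    f (act M Z) = ((M : Matrix (Fin n ⊕ Fin n) (Fin n ⊕ Fin n) ℂ).det ^ r)⁻¹ *
      (denom M Z).det ^ (2 * r) * f Z
  bounded : ∀ Y₀ : Matrix (Fin n) (Fin n) ℂ, Y₀.PosDef →
    ∃ C : ℝ, ∀ Z : Matrix (Fin n) (Fin n) ℂ, (imPart Z - Y₀).PosSemidef → ‖f Z‖ ≤ C

end HermTheta

end

/-! The discriminant hypothesis makes `(√(-ℓ))⁻¹ O_L` the inverse different of `L`. Hence the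
condition `Λ* = √(-ℓ) Λ` says exactly that `Λ` is its own dual for the integral form `Tr ∘ h = 2 Re
h` (`exists_int_two_mul_re_form`, `mem_of_forall_two_mul_re_form`, `exists_int_dual_bases`).
Embedding `V` in `ℂ^d` so that `2h` becomes the standard form (`exists_embedding`) turns `Λ^n` into
a self-dual lattice in the Euclidean space `ℂ^(d × n)`.

At `Z = iY` with `Y = pᴴ p` the theta series is a Gaussian sum over the image of this lattice under
`p`. Poisson summation (`tsum_intVec_eq_tsum_fourier`) exchanges `p` with its inverse adjoint and
produces the real determinant of `p` acting on `d` columns, which is `|det p|^(2d) = (det Y)^d`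
(`tsum_gaussian_of_selfDual`, `theta_I_smul_inv`). The inversion formula at a general `Z = X + iY`
follows by the identity theorem in one variable along `t ↦ tX + iY`: imaginary `t` near `0` is the
case already known, and `t = 1` is the claim (`theta_neg_inv`).

Translations by Hermitian `B` fix `θ` because `trace(GB)` is an integer for every Gram matrix `G`:
off-diagonal entries pair up to values of the trace form, and diagonal entries need `h(x,x) ∈ ℤ`,
which is automatic for odd `ℓ` (`exists_int_trace_gram_mul`). The group `GL_n(O_L)` merely permutes
`Λ^n` (`theta_conj_mul_mul`). In genus one, a word in translation and inversion that fixes `i`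
multiplies `θ(i) > 0` by `(-i)^d`, so `4 ∣ d` (`four_dvd_finrank`).

The cocycle property of `CZ + D` then propagates the transformation law from the generators to the
whole group (`transformsUnder_of_mem_fullModularGroup`). The determinant of a group element is a
unit square up to sign; for `ℓ ≠ 3` all units are fourth roots of unity, so the determinant factor
is trivial (`det_pow_eq_one_of_mem_fullModularGroup`). -/

noncomputable section

namespace HermTheta

/-! ### Poisson summation on `ℝ^ι` through Fourier series on the torus. -/

section Poisson

open MeasureTheory UnitAddTorus Set

variable {ι : Type*}

/-- The integer vector `m`, as a real vector. -/
def intVec (m : ι → ℤ) : ι → ℝ := fun i => (m i : ℝ)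

/-- The quotient map `ℝ^ι → (ℝ/ℤ)^ι`. -/
def torusMk (x : ι → ℝ) : UnitAddTorus ι := fun i => (x i : UnitAddCircle)

theorem intVec_add (m n : ι → ℤ) : intVec (m + n) = intVec m + intVec n := by
  ext i; simp [intVec]

theorem isOpenQuotientMap_torusMk : IsOpenQuotientMap (torusMk : (ι → ℝ) → UnitAddTorus ι) :=
  IsOpenQuotientMap.piMap (f := fun _ : ι => ((↑) : ℝ → UnitAddCircle))
    fun _ => QuotientAddGroup.isOpenQuotientMap_mk

theorem torusMk_eq_iff {x y : ι → ℝ} :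
    torusMk x = torusMk y ↔ ∃ m : ι → ℤ, y = x + intVec m := by
  constructor
  · intro h
    have : ∀ i, ∃ m : ℤ, y i = x i + m := by
      intro i
      have hi : ((x i : ℝ) : UnitAddCircle) = (y i : ℝ) := congrFun h i
      rw [← sub_eq_zero, ← AddCircle.coe_sub, AddCircle.coe_eq_zero_iff] at hi
      obtain ⟨m, hm⟩ := hi
      refine ⟨-m, ?_⟩
      simp at hm
      push_cast
      linarith
    choose m hm using this
    exact ⟨m, funext hm⟩
  · rintro ⟨m, rfl⟩
    ext i
    simp only [torusMk, intVec, Pi.add_apply, AddCircle.coe_add]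
    have : ((m i : ℝ) : UnitAddCircle) = 0 := by
      rw [AddCircle.coe_eq_zero_iff]; exact ⟨m i, by simp⟩
    rw [this, add_zero]

/-- The half-open unit cube with lower corner `m`. -/
def unitCube (m : ι → ℤ) : Set (ι → ℝ) := {x | ∀ i, x i ∈ Ioc (m i : ℝ) (m i + 1)}

theorem iUnion_unitCube : ⋃ m : ι → ℤ, unitCube m = univ := by
  -- The cubes are open below and closed above, so the corner is the ceiling minus one and not the
  -- floor.
  refine eq_univ_of_forall fun x => mem_iUnion.2 ⟨fun i => ⌈x i⌉ - 1, fun i => ?_⟩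
  have h1 := Int.le_ceil (x i)
  have h2 := Int.ceil_lt_add_one (x i)
  constructor <;> push_cast <;> linarith

theorem pairwise_disjoint_unitCube :
    Pairwise (Function.onFun Disjoint (unitCube : (ι → ℤ) → Set (ι → ℝ))) := by
  intro m n hmn
  rw [Function.onFun, Set.disjoint_left]
  intro x hx hy
  apply hmn
  ext i
  have h1 := hx i
  have h2 := hy i
  have h3 : (m i : ℝ) < n i + 1 := h1.1.trans_le h2.2
  have h4 : (n i : ℝ) < m i + 1 := h2.1.trans_le h1.2
  have h5 : m i < n i + 1 := by exact_mod_cast h3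
  have h6 : n i < m i + 1 := by exact_mod_cast h4
  omega

variable [Fintype ι]

theorem mFourier_torusMk (n : ι → ℤ) (x : ι → ℝ) :
    mFourier n (torusMk x) = Complex.exp (2 * Real.pi * Complex.I * ∑ i, (n i : ℂ) * x i) := by
  simp only [mFourier, torusMk, ContinuousMap.coe_mk, fourier_coe_apply, Finset.mul_sum,
    Complex.exp_sum]
  refine Finset.prod_congr rfl fun i _ => ?_
  congr 1
  push_cast
  ring

theorem measurableSet_unitCube (m : ι → ℤ) : MeasurableSet (unitCube m) :=
  MeasurableSet.univ_pi' fun _ => measurableSet_Ioc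

theorem hasSum_setIntegral_unitCube {k : (ι → ℝ) → ℂ} (hk : Integrable k) :
    HasSum (fun m : ι → ℤ => ∫ x in unitCube (0 : ι → ℤ), k (x + intVec m)) (∫ x, k x) := by
  have := hasSum_integral_iUnion (μ := volume) (f := k) (s := unitCube (ι := ι))
    measurableSet_unitCube pairwise_disjoint_unitCube hk.integrableOn
  rw [iUnion_unitCube, setIntegral_univ] at this
  convert! this using 2 with m
  have hmp : MeasurePreserving (fun x : ι → ℝ => x + intVec m) volume volume :=
    measurePreserving_add_right volume (intVec m)
  rw [← hmp.setIntegral_preimage_emb (measurableEmbedding_addRight _) k (unitCube m)]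
  congr 2
  ext x
  simp only [unitCube, intVec, mem_ofPred_eq, mem_preimage, mem_Ioc, Pi.add_apply, Pi.zero_apply]
  push_cast
  refine forall_congr' fun i => and_congr ?_ ?_ <;> constructor <;> intro h <;> linarith

theorem volume_unitCube_lt_top (m : ι → ℤ) : volume (unitCube m) < ⊤ := by
  refine lt_of_le_of_lt (measure_mono (t := Icc (intVec m) (intVec m + 1)) ?_)
    isCompact_Icc.measure_lt_top
  intro x hx
  exact ⟨fun i => (hx i).1.le, fun i => (hx i).2⟩

/-- **Poisson summation** for the lattice `ℤ^ι` in `ℝ^ι`. -/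
theorem tsum_intVec_eq_tsum_fourier {g : (ι → ℝ) → ℂ} (hg : Continuous g) (hint : Integrable g)
    (hloc : ∀ R : ℝ, ∃ u : (ι → ℤ) → ℝ, Summable u ∧
      ∀ m x, ‖x‖ ≤ R → ‖g (x + intVec m)‖ ≤ u m)
    (hsum : Summable fun n : ι → ℤ =>
      ∫ x, Complex.exp (-(2 * Real.pi * Complex.I * ∑ i, (n i : ℂ) * x i)) * g x) :
    ∑' m : ι → ℤ, g (intVec m) = ∑' n : ι → ℤ,
      ∫ x, Complex.exp (-(2 * Real.pi * Complex.I * ∑ i, (n i : ℂ) * x i)) * g x := by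
  -- The periodization of `g`; the locally uniform majorant `hloc` makes it continuous.
  set G : (ι → ℝ) → ℂ := fun x => ∑' m : ι → ℤ, g (x + intVec m) with hG
  have hGc : Continuous G := by
    rw [continuous_iff_continuousAt]
    intro x0
    obtain ⟨u, hu, hb⟩ := hloc (‖x0‖ + 1)
    have : ContinuousOn G (Metric.ball 0 (‖x0‖ + 1)) := by
      refine continuousOn_tsum (fun m => Continuous.continuousOn (by fun_prop)) hu ?_
      intro m x hx
      exact hb m x (by simpa using (mem_ball_zero_iff.1 hx).le)
    exact this.continuousAt (Metric.isOpen_ball.mem_nhds (by simp))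
  have hGp : ∀ x m, G (x + intVec m) = G x := by
    intro x m
    simp only [hG]
    rw [← (Equiv.addLeft m).tsum_eq (fun k => g (x + intVec k))]
    simp [intVec_add, add_assoc]
  have hsurj := (isOpenQuotientMap_torusMk (ι := ι)).surjective
  -- Periodicity lets `G` descend to the torus, evaluated at an arbitrary preimage; continuity
  -- passes down because `torusMk` is a quotient map.
  let F0 : UnitAddTorus ι → ℂ := fun t => G (Function.surjInv hsurj t)
  have hF0 : ∀ x, F0 (torusMk x) = G x := by
    intro x
    obtain ⟨m, hm⟩ := torusMk_eq_iff.1 (Function.surjInv_eq hsurj (torusMk x))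
    simp only [F0]
    rw [hm, hGp]
    simp [← hm]
  let F : C(UnitAddTorus ι, ℂ) := ⟨F0, by
    rw [(isOpenQuotientMap_torusMk (ι := ι)).isQuotientMap.continuous_iff]
    convert! hGc
    ext x
    exact hF0 x⟩
  have hcoef : ∀ n, mFourierCoeff F n =
      ∫ x, Complex.exp (-(2 * Real.pi * Complex.I * ∑ i, (n i : ℂ) * x i)) * g x := by
    intro n
    rw [mFourierCoeff_eq_integral (F : UnitAddTorus ι → ℂ) n 0]
    set k : (ι → ℝ) → ℂ := fun x =>
      Complex.exp (-(2 * Real.pi * Complex.I * ∑ i, (n i : ℂ) * x i)) * g x with hk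
    have hkc : Continuous k := by fun_prop
    have hnorm : ∀ x, ‖k x‖ = ‖g x‖ := by
      intro x
      rw [hk]
      simp only [norm_mul]
      have : -(2 * Real.pi * Complex.I * ∑ i, (n i : ℂ) * x i) =
          ((-(2 * Real.pi * ∑ i, (n i : ℝ) * x i) : ℝ) : ℂ) * Complex.I := by
        push_cast; ring
      rw [this, Complex.norm_exp_ofReal_mul_I, one_mul]
    have hki : Integrable k := by
      refine hint.norm.mono' hkc.aestronglyMeasurable (Filter.Eventually.of_forall fun x => ?_)
      rw [hnorm]
    have hks := hasSum_setIntegral_unitCube hki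
    rw [← hks.tsum_eq]
    have hset : {x : ι → ℝ | ∀ i, x i ∈ Ioc ((0 : ι → ℝ) i) ((0 : ι → ℝ) i + 1)} =
        unitCube (0 : ι → ℤ) := by
      ext x; simp [unitCube]
    rw [hset]
    have hR : ∀ x ∈ unitCube (0 : ι → ℤ), ‖x‖ ≤ 1 := by
      intro x hx
      refine (pi_norm_le_iff_of_nonneg zero_le_one).2 fun i => ?_
      have := hx i
      simp at this
      rw [Real.norm_eq_abs, abs_of_pos this.1]
      exact this.2
    obtain ⟨u, hu, hb⟩ := hloc 1
    -- Unfolding: the integral of the sum over one cube becomes the integral over `ℝ^ι`. The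
    -- exchange is justified by the majorant on the bounded cube.
    rw [integral_tsum_of_summable_integral_norm]
    · refine setIntegral_congr_fun (measurableSet_unitCube _) fun x hx => ?_
      change mFourier (-n) (torusMk x) • F0 (torusMk x) = _
      rw [hF0, mFourier_torusMk, hG, smul_eq_mul, ← tsum_mul_left]
      refine tsum_congr fun m => ?_
      rw [hk]
      simp only
      congr 1
      rw [Complex.exp_eq_exp_iff_exists_int]
      -- Translating `x` by the integer vector `m` changes the phase by `2πi` times this integer.
      refine ⟨∑ i, n i * m i, ?_⟩
      simp only [intVec, Pi.neg_apply, Pi.add_apply]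
      push_cast
      simp only [neg_mul, Finset.sum_neg_distrib, mul_add, Finset.sum_add_distrib]
      ring
    · intro m
      refine Integrable.integrableOn ?_
      exact hki.comp_add_right (intVec m)
    · refine Summable.of_nonneg_of_le (fun m => integral_nonneg fun x => norm_nonneg _)
        (f := fun m => u m * volume.real (unitCube (0 : ι → ℤ))) (fun m => ?_) (hu.mul_right _)
      have := norm_setIntegral_le_of_norm_le_const (μ := volume)
        (f := fun x => (‖k (x + intVec m)‖ : ℝ)) (C := u m) (volume_unitCube_lt_top (0 : ι → ℤ))
        (fun x hx => by rw [norm_norm, hnorm]; exact hb m x (hR x hx))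
      exact (Real.le_norm_self _).trans this
  have hS : Summable (mFourierCoeff F) := by
    rw [show mFourierCoeff F = _ from funext hcoef]; exact hsum
  -- Summable coefficients make the Fourier series converge pointwise to `F`; its value at the
  -- origin is the Poisson formula.
  have := (hasSum_mFourier_series_apply_of_summable hS (torusMk 0)).tsum_eq
  have h0 : ∀ n, mFourier n (torusMk (0 : ι → ℝ)) = 1 := by
    intro n; rw [mFourier_torusMk]; simp
  simp only [h0, hcoef, smul_eq_mul, mul_one] at this
  rw [this]
  change _ = F0 (torusMk 0)
  rw [hF0, hG]
  simp

end Poisson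

/-! ### Gaussian sums over lattices and their inversion. -/

section LatticeGaussian

open MeasureTheory Module

/-- From `‖y‖² ≤ 2‖x + y‖² + 2‖x‖²`. With `x` bounded and `y` running through a lattice, this is the
majorant that Poisson summation asks for. -/
theorem exp_neg_sq_norm_add_le {E : Type*} [SeminormedAddCommGroup E] {c : ℝ} (hc : 0 ≤ c) (x y : E) :
    Real.exp (-c * ‖x + y‖ ^ 2) ≤ Real.exp (c * ‖x‖ ^ 2) * Real.exp (-(c / 2) * ‖y‖ ^ 2) := by
  rw [← Real.exp_add, Real.exp_le_exp]
  have h1 : ‖y‖ ≤ ‖x + y‖ + ‖x‖ := by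
    calc ‖y‖ = ‖(x + y) - x‖ := by congr 1; abel
      _ ≤ _ := norm_sub_le _ _
  have h2 : ‖y‖ ^ 2 ≤ 2 * ‖x + y‖ ^ 2 + 2 * ‖x‖ ^ 2 := by
    have := pow_le_pow_left₀ (norm_nonneg y) h1 2
    nlinarith [sq_nonneg (‖x + y‖ - ‖x‖)]
  nlinarith

variable {ι : Type*} [Fintype ι] {E : Type*} [NormedAddCommGroup E] [InnerProductSpace ℝ E]

theorem summable_exp_neg_mul_sq_norm (b : Basis ι ℝ E) {c : ℝ} (hc : 0 < c) :
    Summable fun m : ι → ℤ => Real.exp (-c * ‖b.equivFun.symm (intVec m)‖ ^ 2) := by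
  classical
  have : FiniteDimensional ℝ E := b.finiteDimensional_of_finite
  set Λ : Submodule ℤ E := Submodule.span ℤ (Set.range b) with hΛ
  let e : (ι → ℤ) ≃ Λ := (b.restrictScalars ℤ).equivFun.symm.toEquiv
  have he : ∀ m, (e m : E) = b.equivFun.symm (intVec m) := by
    intro m
    simp only [e, LinearEquiv.coe_toEquiv, Basis.equivFun_symm_apply, intVec]
    simp [← Int.cast_smul_eq_zsmul ℝ]
  have hs : Summable fun z : Λ => Real.exp (-c * ‖(z : E)‖ ^ 2) := by
    -- The bound `exp t ≥ t^k / k!` compares the Gaussian with `‖z‖^(-2k)`, which is summable over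
    -- the lattice because `2k` exceeds its rank. The origin is set aside, since the comparison
    -- fails there.
    set k := finrank ℤ Λ + 1 with hk
    have h1 := (ZLattice.summable_norm_pow_inv (L := Λ) (2 * k) (by omega)).mul_left
      ((k.factorial : ℝ) / c ^ k)
    refine h1.of_norm_bounded_eventually ?_
    filter_upwards [(Set.finite_singleton (0 : Λ)).compl_mem_cofinite] with z hz
    simp only [Set.mem_compl_iff, Set.mem_singleton_iff] at hz
    have hz' : 0 < ‖(z : E)‖ := by simpa using hz
    rw [Real.norm_eq_abs, abs_of_pos (Real.exp_pos _), neg_mul, Real.exp_neg]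
    have h2 := Real.pow_div_factorial_le_exp (c * ‖(z : E)‖ ^ 2) (by positivity) k
    have h3 : 0 < (c * ‖(z : E)‖ ^ 2) ^ k / k.factorial := by positivity
    refine (inv_anti₀ h3 h2).trans (le_of_eq ?_)
    rw [mul_pow, ← pow_mul, inv_div, inv_pow, show ‖z‖ = ‖(z : E)‖ from rfl]
    field_simp
  refine (e.summable_iff.2 hs).congr fun m => ?_
  simp only [Function.comp, he]

theorem linearIndependent_of_dual [DecidableEq ι] {b b' : ι → E}
    (hdual : ∀ i j, inner ℝ (b' i) (b j) = if i = j then (1 : ℝ) else 0) :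
    LinearIndependent ℝ b := by
  rw [Fintype.linearIndependent_iff]
  intro a ha i
  have := congrArg (fun v => inner ℝ (b' i) v) ha
  simpa [inner_sum, inner_smul_right, hdual] using this

theorem equivFun_symm_intVec {X : Type*} [AddCommGroup X] {B : Basis ι ℤ X} {φ : X →ₗ[ℤ] E}
    {b : Basis ι ℝ E} (hb : ∀ i, b i = φ (B i)) (m : ι → ℤ) :
    φ (B.equivFun.symm m) = b.equivFun.symm (intVec m) := by
  simp [Basis.equivFun_symm_apply, hb, intVec, ← Int.cast_smul_eq_zsmul ℝ]

/-- Gaussian sums over a lattice converge. -/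
theorem summable_gaussian_of_basis {X : Type*} [AddCommGroup X]
    {B : Basis ι ℤ X} {φ : X →ₗ[ℤ] E} {b : Basis ι ℝ E} (hb : ∀ i, b i = φ (B i))
    {c : ℝ} (hc : 0 < c) : Summable fun x : X => Real.exp (-c * ‖φ x‖ ^ 2) := by
  rw [← B.equivFun.symm.toEquiv.summable_iff]
  refine (summable_exp_neg_mul_sq_norm b hc).congr fun m => ?_
  simp only [Function.comp, LinearEquiv.coe_toEquiv, equivFun_symm_intVec hb]

variable [MeasurableSpace E] [BorelSpace E] [FiniteDimensional ℝ E]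

/-- Poisson summation for the Gaussian on the lattice spanned by a basis `b` with dual basis `b'`,
where `c` is the inverse of the covolume. -/
theorem tsum_gaussian_basis [DecidableEq ι] (b b' : Basis ι ℝ E)
    (hdual : ∀ i j, inner ℝ (b' i) (b j) = if i = j then (1 : ℝ) else 0) {c : ENNReal} (hct : c ≠ ⊤)
    (hc : Measure.map b.equivFun.symm volume = c • (volume : Measure E)) :
    ∑' m : ι → ℤ, Real.exp (-Real.pi * ‖b.equivFun.symm (intVec m)‖ ^ 2) =
      c.toReal * ∑' m : ι → ℤ, Real.exp (-Real.pi * ‖b'.equivFun.symm (intVec m)‖ ^ 2) := by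
  let e : (ι → ℝ) ≃L[ℝ] E := b.equivFun.symm.toContinuousLinearEquiv
  have he : ∀ x, b.equivFun.symm x = e x := fun _ => rfl
  -- In the coordinates of `b`, the character with frequency `n` is the pairing with the vector of
  -- integral coordinates `n` in the dual basis.
  have hinner : ∀ (n : ι → ℤ) (x : ι → ℝ),
      inner ℝ (b'.equivFun.symm (intVec n)) (e x) = ∑ i, (n i : ℝ) * x i := by
    intro n x
    rw [← he, Basis.equivFun_symm_apply, Basis.equivFun_symm_apply, sum_inner]
    refine Finset.sum_congr rfl fun i _ => ?_
    rw [inner_sum]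
    simp [inner_smul_left, inner_smul_right, hdual, intVec, mul_comm]
  let g : (ι → ℝ) → ℂ := fun x => Complex.exp (-Real.pi * ‖e x‖ ^ 2)
  have hgn : ∀ x, ‖g x‖ = Real.exp (-Real.pi * ‖e x‖ ^ 2) := by
    intro x
    simp only [g]
    rw [Complex.norm_exp]
    congr 1
    rw [show (-(Real.pi : ℂ) * (‖e x‖ : ℂ) ^ 2) = ((-Real.pi * ‖e x‖ ^ 2 : ℝ) : ℂ) by push_cast; rfl,
      Complex.ofReal_re]
  have hgc : Continuous g := by fun_prop
  have hmap : ∀ k : E → ℂ, ∫ x, k (e x) = c.toReal • ∫ v, k v := by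
    intro k
    rw [← integral_smul_measure, ← hc]
    exact (e.toHomeomorph.measurableEmbedding.integral_map k).symm
  have hexp : ∀ (n : ι → ℤ) (x : ι → ℝ),
      Complex.exp (-(2 * Real.pi * Complex.I * ∑ i, (n i : ℂ) * x i)) * g x =
      Complex.exp (-Real.pi * ‖e x‖ ^ 2 + (-(2 * Real.pi * Complex.I)) *
        (inner ℝ (b'.equivFun.symm (intVec n)) (e x) : ℝ)) := by
    intro n x
    simp only [g]
    rw [← Complex.exp_add, hinner]
    congr 1
    push_cast
    ring
  have hpi : 0 < (Real.pi : ℂ).re := by simpa using Real.pi_pos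
  -- The Gaussian `exp(-π‖v‖²)` is its own Fourier transform; the change of variables contributes
  -- `c`.
  have hcoef : ∀ n : ι → ℤ,
      ∫ x, Complex.exp (-(2 * Real.pi * Complex.I * ∑ i, (n i : ℂ) * x i)) * g x =
      ((c.toReal * Real.exp (-Real.pi * ‖b'.equivFun.symm (intVec n)‖ ^ 2) : ℝ) : ℂ) := by
    intro n
    simp_rw [hexp]
    rw [hmap fun v => Complex.exp (-Real.pi * ‖v‖ ^ 2 + (-(2 * Real.pi * Complex.I)) *
        (inner ℝ (b'.equivFun.symm (intVec n)) v : ℝ)),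
      GaussianFourier.integral_cexp_neg_mul_sq_norm_add hpi]
    have hpi0 : (Real.pi : ℂ) ≠ 0 := by simp
    rw [div_self hpi0, Complex.one_cpow, one_mul, Complex.real_smul]
    push_cast
    congr 2
    field_simp
    linear_combination (4 * ‖b'.equivFun.symm (intVec n)‖ ^ 2 : ℂ) * Complex.I_sq
  have hgi : Integrable g := by
    have h1 : Integrable (fun v : E => Complex.exp (-Real.pi * ‖v‖ ^ 2)) := by
      simpa using GaussianFourier.integrable_cexp_neg_mul_sq_norm_add hpi 0 (0 : E)
    have h2 : Integrable (fun v : E => Complex.exp (-Real.pi * ‖v‖ ^ 2))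
        (Measure.map e volume) := by
      change Integrable _ (Measure.map b.equivFun.symm volume)
      rw [hc]
      exact h1.smul_measure hct
    exact (e.toHomeomorph.measurableEmbedding.integrable_map_iff).1 h2
  have hsum := summable_exp_neg_mul_sq_norm b' Real.pi_pos
  have hP := tsum_intVec_eq_tsum_fourier hgc hgi ?_ ?_
  · simp_rw [hcoef] at hP
    rw [← Complex.ofReal_inj, ← tsum_mul_left, Complex.ofReal_tsum, Complex.ofReal_tsum, ← hP]
    refine tsum_congr fun m => ?_
    simp [g, he]
  · intro R
    refine ⟨fun m => Real.exp (Real.pi * (‖(e : (ι → ℝ) →L[ℝ] E)‖ * R) ^ 2) *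
      Real.exp (-(Real.pi / 2) * ‖b.equivFun.symm (intVec m)‖ ^ 2),
      (summable_exp_neg_mul_sq_norm b Real.pi_div_two_pos).mul_left _, fun m x hx => ?_⟩
    rw [hgn, map_add]
    refine (exp_neg_sq_norm_add_le Real.pi_pos.le _ _).trans ?_
    simp only [he]
    have := Real.pi_pos
    gcongr
    exact ((e : (ι → ℝ) →L[ℝ] E).le_opNorm x).trans (by gcongr)
  · simp_rw [hcoef]
    rw [Complex.summable_ofReal]
    exact hsum.mul_left _

/-- Inversion formula for Gaussian sums over a self-dual lattice `φ(X)`. -/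
theorem tsum_gaussian_of_selfDual [DecidableEq ι] {X : Type*} [AddCommGroup X]
    (B B' : Basis ι ℤ X) (φ : X →ₗ[ℤ] E)
    (hdual : ∀ i j, inner ℝ (φ (B' i)) (φ (B j)) = if i = j then (1 : ℝ) else 0)
    (hspan : Submodule.span ℝ (Set.range fun i => φ (B i)) = ⊤)
    (P Q : E ≃ₗ[ℝ] E) (hPQ : ∀ x y, inner ℝ (P x) (Q y) = inner ℝ x y) :
    ∑' x : X, Real.exp (-Real.pi * ‖P (φ x)‖ ^ 2) =
      |LinearMap.det (P : E →ₗ[ℝ] E)|⁻¹ * ∑' x : X, Real.exp (-Real.pi * ‖Q (φ x)‖ ^ 2) := by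
  have hdual' : ∀ i j, inner ℝ (φ (B i)) (φ (B' j)) = if i = j then (1 : ℝ) else 0 := by
    intro i j; rw [real_inner_comm, hdual]; simp only [eq_comm]
  have hli' : LinearIndependent ℝ fun i => φ (B' i) := linearIndependent_of_dual hdual'
  let b : Basis ι ℝ E := Basis.mk (linearIndependent_of_dual hdual) hspan.ge
  have hcard : Fintype.card ι = finrank ℝ E := (finrank_eq_card_basis b).symm
  have hspan' := hli'.span_eq_top_of_card_eq_finrank' hcard
  let b' : Basis ι ℝ E := Basis.mk hli' hspan'.ge
  have hb : ∀ i, b i = φ (B i) := fun i => by simp [b]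
  have hb' : ∀ i, b' i = φ (B' i) := fun i => by simp [b']
  -- Uniqueness of Haar measure supplies `c` without identifying it. Replacing `b` by its image
  -- under `P` multiplies it by `|det P|⁻¹`.
  obtain ⟨c, hct, hc⟩ : ∃ c : ENNReal, c ≠ ⊤ ∧
      Measure.map b.equivFun.symm volume = c • (volume : Measure E) :=
    ⟨_, ENNReal.coe_ne_top, Measure.isAddLeftInvariant_eq_smul
      (Measure.map b.equivFun.symm.toContinuousLinearEquiv volume) (volume : Measure E)⟩
  have key : ∀ (P Q : E ≃ₗ[ℝ] E) (hPQ : ∀ x y, inner ℝ (P x) (Q y) = inner ℝ x y),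
      ∑' x : X, Real.exp (-Real.pi * ‖P (φ x)‖ ^ 2) =
      (c.toReal * |LinearMap.det (P : E →ₗ[ℝ] E)|⁻¹) *
        ∑' x : X, Real.exp (-Real.pi * ‖Q (φ x)‖ ^ 2) := by
    intro P Q hPQ
    have hdet : LinearMap.det (P : E →ₗ[ℝ] E) ≠ 0 := (LinearEquiv.isUnit_det' P).ne_zero
    have h1 := tsum_gaussian_basis (b.map P) (b'.map Q)
      (fun i j => by simp only [Basis.map_apply]; rw [real_inner_comm, hPQ, hb, hb', hdual']; simp only [eq_comm])
      (c := c * ENNReal.ofReal |(LinearMap.det (P : E →ₗ[ℝ] E))⁻¹|)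
      (ENNReal.mul_ne_top hct ENNReal.ofReal_ne_top) ?_
    · rw [ENNReal.toReal_mul, ENNReal.toReal_ofReal (abs_nonneg _), abs_inv] at h1
      rw [← B.equivFun.symm.toEquiv.tsum_eq, ← B'.equivFun.symm.toEquiv.tsum_eq]
      convert! h1 using 6 with m m
      · congr 2
        rw [LinearEquiv.coe_toEquiv, equivFun_symm_intVec hb]
        simp [Basis.equivFun_symm_apply]
      · congr 2
        rw [LinearEquiv.coe_toEquiv, equivFun_symm_intVec hb']
        simp [Basis.equivFun_symm_apply]
    · have hcomp : ⇑(b.map P).equivFun.symm = (P : E →ₗ[ℝ] E) ∘ b.equivFun.symm := by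
        ext x; simp [Basis.equivFun_symm_apply]
      have hPc : Continuous (P : E →ₗ[ℝ] E) := LinearMap.continuous_of_finiteDimensional _
      have hbc : Continuous (b.equivFun.symm) :=
        LinearMap.continuous_of_finiteDimensional (b.equivFun.symm : (ι → ℝ) →ₗ[ℝ] E)
      rw [hcomp, ← Measure.map_map hPc.measurable hbc.measurable, hc, Measure.map_smul,
        Measure.map_linearMap_addHaar_eq_smul_addHaar _ hdet, smul_smul]
  -- For `P = Q = 1` both sums coincide and are positive, which forces `c = 1`: a self-dual lattice
  -- has covolume one.
  have h1 := key (LinearEquiv.refl ℝ E) (LinearEquiv.refl ℝ E) (fun _ _ => rfl)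
  have hpos : 0 < ∑' x : X, Real.exp (-Real.pi * ‖φ x‖ ^ 2) :=
    (summable_gaussian_of_basis hb Real.pi_pos).tsum_pos (fun _ => (Real.exp_pos _).le) 0
      (Real.exp_pos _)
  have hc1 : c.toReal = 1 := by
    simp only [LinearEquiv.refl_apply, LinearEquiv.refl_toLinearMap, LinearMap.det_id, abs_one,
      inv_one, mul_one] at h1
    exact (mul_right_cancel₀ hpos.ne' ((one_mul _).trans h1)).symm
  rw [key P Q hPQ, hc1, one_mul]

end LatticeGaussian

/-! ### Arithmetic of `L`: traces, norms, the inverse different and units. -/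

section QuadraticField

open Polynomial

variable {ℓ : ℕ}

@[simp]
theorem coe_sqrtNeg : ((sqrtNeg ℓ : L ℓ) : ℂ) = sqrtNegC ℓ := rfl

@[simp]
theorem coe_conjL (z : L ℓ) : ((conjL ℓ z : L ℓ) : ℂ) = starRingEnd ℂ (z : ℂ) := rfl

theorem sqrtNegC_mul_self (ℓ : ℕ) : sqrtNegC ℓ * sqrtNegC ℓ = -(ℓ : ℂ) := by
  have h : (Real.sqrt ℓ : ℂ) * (Real.sqrt ℓ : ℂ) = (ℓ : ℂ) := by
    rw [← Complex.ofReal_mul, Real.mul_self_sqrt (Nat.cast_nonneg ℓ), Complex.ofReal_natCast]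
  rw [sqrtNegC]
  linear_combination (-1 : ℂ) * h + (Real.sqrt ℓ : ℂ) * (Real.sqrt ℓ : ℂ) * Complex.I_mul_I

@[simp]
theorem sqrtNegC_re (ℓ : ℕ) : (sqrtNegC ℓ).re = 0 := by simp [sqrtNegC]

@[simp]
theorem sqrtNegC_im (ℓ : ℕ) : (sqrtNegC ℓ).im = Real.sqrt ℓ := by simp [sqrtNegC]

theorem isIntegral_sqrtNegC (ℓ : ℕ) : IsIntegral ℤ (sqrtNegC ℓ) :=
  ⟨X ^ 2 + C (ℓ : ℤ), monic_X_pow_add_C _ two_ne_zero, by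
    simp only [eval₂_add, eval₂_pow, eval₂_X, eval₂_C]
    rw [pow_two, sqrtNegC_mul_self]
    simp⟩

instance : NumberField (L ℓ) where
  to_finiteDimensional := IntermediateField.adjoin.finiteDimensional
    ((isIntegral_sqrtNegC ℓ).tower_top)

theorem IsNegFundamentalDiscriminant.pos (h : IsNegFundamentalDiscriminant ℓ) : 0 < ℓ := by
  rcases h with ⟨h, _⟩ | ⟨m, h, h', _⟩ <;> omega

/-- Every element of `L` is `a + b √(-ℓ)` with rational `a`, `b`. -/
theorem exists_rat_coords (z : L ℓ) : ∃ a b : ℚ, (z : ℂ) = a + b * sqrtNegC ℓ := by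
  have hz : (z : ℂ) ∈ (L ℓ).toSubalgebra := z.2
  rw [IntermediateField.adjoin_simple_toSubalgebra_of_isAlgebraic
    (((isIntegral_sqrtNegC ℓ).tower_top (A := ℚ)).isAlgebraic)] at hz
  generalize (z : ℂ) = w at hz ⊢
  induction hz using Algebra.adjoin_induction with
  | mem x hx =>
    rw [Set.mem_singleton_iff.1 hx]
    exact ⟨0, 1, by simp⟩
  | algebraMap r => exact ⟨r, 0, by simp⟩
  | add x y _ _ hx hy =>
    obtain ⟨a, b, rfl⟩ := hx
    obtain ⟨c, d, rfl⟩ := hy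
    exact ⟨a + c, b + d, by push_cast; ring⟩
  | mul x y _ _ hx hy =>
    obtain ⟨a, b, rfl⟩ := hx
    obtain ⟨c, d, rfl⟩ := hy
    refine ⟨a * c - b * d * ℓ, a * d + b * c, ?_⟩
    push_cast
    linear_combination (b * d : ℂ) * sqrtNegC_mul_self ℓ

theorem exists_rat_re (z : L ℓ) : ∃ a : ℚ, (z : ℂ).re = a := by
  obtain ⟨a, b, h⟩ := exists_rat_coords z
  refine ⟨a, ?_⟩
  rw [h]
  simp

/-- The trace `z + conj z` from `L` to `ℚ`. -/
def traceL (ℓ : ℕ) : L ℓ →ₗ[ℚ] ℚ where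
  toFun z := 2 * (exists_rat_re z).choose
  map_add' x y := by
    rw [← mul_add]
    congr 1
    apply Rat.cast_injective (α := ℝ)
    push_cast
    rw [← (exists_rat_re x).choose_spec, ← (exists_rat_re y).choose_spec,
      ← (exists_rat_re (x + y)).choose_spec]
    simp
  map_smul' r x := by
    apply Rat.cast_injective (α := ℝ)
    push_cast
    rw [smul_eq_mul]
    push_cast
    rw [← (exists_rat_re x).choose_spec, ← (exists_rat_re (r • x)).choose_spec]
    simp [Algebra.smul_def]
    ring

theorem coe_traceL (z : L ℓ) : ((traceL ℓ z : ℚ) : ℝ) = 2 * (z : ℂ).re := by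
  rw [(exists_rat_re z).choose_spec]
  simp [traceL]

theorem exists_int_of_isIntegral {q : ℚ} (h : IsIntegral ℤ (q : ℂ)) : ∃ n : ℤ, q = n := by
  have h' : IsIntegral ℤ (algebraMap ℚ ℂ q) := by simpa using h
  rw [isIntegral_algebraMap_iff (algebraMap ℚ ℂ).injective,
    IsIntegrallyClosed.isIntegral_iff] at h'
  obtain ⟨n, hn⟩ := h'
  exact ⟨n, by simpa using hn.symm⟩

theorem isIntegral_coe (α : 𝓞 (L ℓ)) : IsIntegral ℤ ((α : L ℓ) : ℂ) :=
  (RingOfIntegers.isIntegral_coe α).map ((L ℓ).val.restrictScalars ℤ)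

theorem isIntegral_conj {z : ℂ} (h : IsIntegral ℤ z) : IsIntegral ℤ (starRingEnd ℂ z) :=
  h.map (Complex.conjAe.toAlgHom.restrictScalars ℤ)

theorem exists_int_two_mul_re (α : 𝓞 (L ℓ)) : ∃ n : ℤ, 2 * ((α : L ℓ) : ℂ).re = n := by
  obtain ⟨a, ha⟩ := exists_rat_re (α : L ℓ)
  have h := (isIntegral_coe α).add (isIntegral_conj (isIntegral_coe α))
  rw [Complex.add_conj, ha, show (((2 * (a : ℝ) : ℝ)) : ℂ) = ((2 * a : ℚ) : ℂ) by push_cast; rfl] at h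
  obtain ⟨n, hn⟩ := exists_int_of_isIntegral h
  refine ⟨n, ?_⟩
  rw [ha]
  exact_mod_cast hn

theorem exists_int_normSq (α : 𝓞 (L ℓ)) : ∃ n : ℤ, Complex.normSq ((α : L ℓ) : ℂ) = n := by
  obtain ⟨a, b, hab⟩ := exists_rat_coords (α : L ℓ)
  have hN : Complex.normSq ((α : L ℓ) : ℂ) = ((a ^ 2 + b ^ 2 * ℓ : ℚ) : ℝ) := by
    rw [hab, Complex.normSq_apply]
    have := Real.mul_self_sqrt (Nat.cast_nonneg (α := ℝ) ℓ)
    simp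
    linear_combination (b : ℝ) ^ 2 * this
  have h := (isIntegral_coe α).mul (isIntegral_conj (isIntegral_coe α))
  rw [Complex.mul_conj, hN, Complex.ofReal_ratCast] at h
  obtain ⟨n, hn⟩ := exists_int_of_isIntegral h
  exact ⟨n, by rw [hN, hn]; simp⟩

/-- The square of the denominator of `q` is prime to its numerator, hence divides `s`, so the
denominator is one. -/
theorem exists_int_of_squarefree {s : ℕ} (hs : Squarefree s) {q : ℚ} {k : ℤ}
    (h : (s : ℚ) * q ^ 2 = k) : ∃ n : ℤ, q = n := by
  have hden : (q.den : ℚ) ≠ 0 := by exact_mod_cast q.den_nz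
  have h1 : (s : ℤ) * q.num ^ 2 = k * (q.den : ℤ) ^ 2 := by
    have : (s : ℚ) * q.num ^ 2 = k * (q.den : ℚ) ^ 2 := by
      rw [← h, ← Rat.num_div_den q]
      simp only [Rat.num_div_den]
      nth_rewrite 2 [← Rat.num_div_den q]
      field_simp
    exact_mod_cast this
  have h2 : (q.den : ℤ) ^ 2 ∣ (s : ℤ) := by
    have hc : IsCoprime ((q.den : ℤ) ^ 2) (q.num ^ 2) := by
      apply IsCoprime.pow
      rw [Int.isCoprime_iff_gcd_eq_one, Int.gcd_comm]
      exact q.reduced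
    exact hc.dvd_of_dvd_mul_right ⟨k, by rw [h1]; ring⟩
  have h3 : q.den * q.den ∣ s := by
    rw [← pow_two]; exact_mod_cast h2
  have h4 : q.den = 1 := by simpa using hs _ h3
  exact ⟨q.num, ((Rat.den_eq_one_iff q).1 h4).symm⟩

/-- The different of `L` contains `√(-ℓ)`. -/
theorem exists_int_trace_of_sqrtNeg_mul (hℓ : IsNegFundamentalDiscriminant ℓ) {z : L ℓ}
    {α : 𝓞 (L ℓ)} (h : sqrtNeg ℓ * z = α) : ∃ n : ℤ, 2 * (z : ℂ).re = n := by
  obtain ⟨c, e, hce⟩ := exists_rat_coords z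
  obtain ⟨M, hM⟩ := exists_int_two_mul_re α
  obtain ⟨N, hN⟩ := exists_int_normSq α
  have hs := Real.mul_self_sqrt (Nat.cast_nonneg (α := ℝ) ℓ)
  rw [← h] at hM hN
  have hM' : (2 * (-e * ℓ) : ℚ) = M := by
    have : (2 * (-e * ℓ) : ℝ) = M := by
      rw [← hM, MulMemClass.coe_mul, hce]
      simp
      linear_combination -(e : ℝ) * hs
    exact_mod_cast this
  have hN' : (ℓ * c ^ 2 + (e * ℓ) ^ 2 : ℚ) = N := by
    have : (ℓ * c ^ 2 + (e * ℓ) ^ 2 : ℝ) = N := by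
      rw [← hN, MulMemClass.coe_mul, hce, Complex.normSq_mul, Complex.normSq_apply,
        Complex.normSq_apply]
      simp
      linear_combination (-(e : ℝ) ^ 2 * ℓ) * hs
    exact_mod_cast this
  have hre : (z : ℂ).re = c := by rw [hce]; simp
  suffices ∃ n : ℤ, 2 * c = n by
    obtain ⟨n, hn⟩ := this
    exact ⟨n, by rw [hre]; exact_mod_cast hn⟩
  -- `M` and `N` are the trace and norm of `√(-ℓ) z = -eℓ + c√(-ℓ)`; the combination `4N - M²`
  -- eliminates `e`. For squarefree `ℓ` this already makes `2c` an integer.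
  have hk : (ℓ : ℚ) * (2 * c) ^ 2 = ((4 * N - M ^ 2 : ℤ) : ℚ) := by
    push_cast
    rw [← hM', ← hN']
    ring
  rcases hℓ with ⟨_, hsq⟩ | ⟨m, hm, hm', hsq⟩
  · exact exists_int_of_squarefree hsq hk
  · have hk' : (m : ℚ) * (4 * c) ^ 2 = ((4 * N - M ^ 2 : ℤ) : ℚ) := by
      rw [← hk, hm]; push_cast; ring
    obtain ⟨p, hp⟩ := exists_int_of_squarefree hsq hk'
    rw [hp] at hk'
    have h5 : (m : ℤ) * p ^ 2 = 4 * N - M ^ 2 := by exact_mod_cast hk'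
    have h6 : ((m : ℤ) * p ^ 2 + M ^ 2) % 4 = 0 := by rw [h5]; omega
    -- Only `p = 4c` is known to be an integer so far. As `m p² + M²` is divisible by `4` and `m` is
    -- `1` or `2` modulo `4`, an odd `p` is impossible.
    have h7 : p % 2 = 0 := by
      by_contra hodd
      have hp1 : p ^ 2 % 4 = 1 := by
        have : p % 4 = 1 ∨ p % 4 = 3 := by omega
        rcases this with h | h <;> simp [pow_two, Int.mul_emod, h]
      have hM2 : M ^ 2 % 4 = 0 ∨ M ^ 2 % 4 = 1 := by
        have : M % 4 = 0 ∨ M % 4 = 1 ∨ M % 4 = 2 ∨ M % 4 = 3 := by omega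
        rcases this with h | h | h | h <;> simp [pow_two, Int.mul_emod, h]
      have hm4 : (m : ℤ) % 4 = 1 ∨ (m : ℤ) % 4 = 2 := by omega
      rw [Int.add_emod, Int.mul_emod, hp1] at h6
      rcases hm4 with h | h <;> rcases hM2 with h' | h' <;> rw [h, h'] at h6 <;> omega
    obtain ⟨n, rfl⟩ : ∃ n, p = 2 * n := ⟨p / 2, by omega⟩
    refine ⟨n, ?_⟩
    push_cast at hp
    linarith

/-- For odd discriminant, the rational elements of the inverse different are integers. -/
theorem exists_int_of_sqrtNeg_mul_of_odd (hℓ : IsNegFundamentalDiscriminant ℓ) (hodd : ¬ 4 ∣ ℓ)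
    {z : L ℓ} {α : 𝓞 (L ℓ)} (h : sqrtNeg ℓ * z = α) (hz : (z : ℂ).im = 0) :
    ∃ n : ℤ, (z : ℂ) = n := by
  obtain ⟨c, hc⟩ := exists_rat_re z
  obtain ⟨N, hN⟩ := exists_int_normSq α
  have hs := Real.mul_self_sqrt (Nat.cast_nonneg (α := ℝ) ℓ)
  have hN' : (ℓ * c ^ 2 : ℚ) = N := by
    have : (ℓ * c ^ 2 : ℝ) = N := by
      rw [← hN, ← h, MulMemClass.coe_mul, Complex.normSq_mul, Complex.normSq_apply,
        Complex.normSq_apply, hc, hz]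
      simp
      left
      ring
    exact_mod_cast this
  have hsq : Squarefree ℓ := by
    rcases hℓ with ⟨_, hsq⟩ | ⟨m, hm, -, -⟩
    · exact hsq
    · exact absurd ⟨m, hm⟩ hodd
  obtain ⟨n, hn⟩ := exists_int_of_squarefree hsq hN'
  refine ⟨n, Complex.ext ?_ ?_⟩
  · rw [hc, hn]; simp
  · rw [hz]; simp

/-- The inverse different of `L` is contained in `(√(-ℓ))⁻¹ O_L`. -/
theorem exists_sqrtNeg_mul_eq_of_trace (hℓ : IsNegFundamentalDiscriminant ℓ) {z : L ℓ}
    (h : ∀ α : 𝓞 (L ℓ), ∃ n : ℤ, 2 * ((z * (α : L ℓ) : L ℓ) : ℂ).re = n) :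
    ∃ α : 𝓞 (L ℓ), sqrtNeg ℓ * z = α := by
  obtain ⟨a, b, hab⟩ := exists_rat_coords z
  have hs := Real.mul_self_sqrt (Nat.cast_nonneg (α := ℝ) ℓ)
  obtain ⟨p, hp⟩ := h 1
  have hp' : 2 * a = (p : ℚ) := by
    have : (2 * a : ℝ) = p := by rw [← hp]; simp [hab]
    exact_mod_cast this
  have hsqL : sqrtNeg ℓ * sqrtNeg ℓ = -(ℓ : L ℓ) := by
    apply Subtype.ext
    simpa using sqrtNegC_mul_self ℓ
  have hzL : z = (algebraMap ℚ (L ℓ) a) + (algebraMap ℚ (L ℓ) b) * sqrtNeg ℓ := by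
    apply Subtype.ext
    simpa using hab
  suffices hint : IsIntegral ℤ (sqrtNeg ℓ * z) from ⟨⟨_, hint⟩, rfl⟩
  have hint_int : ∀ n : ℤ, IsIntegral ℤ (n : L ℓ) := fun n => by
    simpa using isIntegral_algebraMap (R := ℤ) (A := L ℓ) (x := n)
  rcases hℓ with ⟨hmod, -⟩ | ⟨m, hm, -, -⟩
  -- Testing the trace on `1` and `ω` is enough: with values `p` and `q` one gets `√(-ℓ) z = (q - p)
  -- + pω`. In the even case below, `ω = √(-ℓ)/2` and `√(-ℓ) z = q + pω`. That `ω` generates `O_L`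
  -- is never needed.
  · have hω : IsIntegral ℤ ((1 + sqrtNeg ℓ) / 2) := by
      refine ⟨X ^ 2 - X + C (((ℓ + 1) / 4 : ℕ) : ℤ), ?_, ?_⟩
      · monicity!
      · have h4 : (((ℓ + 1) / 4 : ℕ) : L ℓ) * 4 = ℓ + 1 := by
          have : (ℓ + 1) / 4 * 4 = ℓ + 1 := by omega
          exact_mod_cast this
        simp only [eval₂_add, eval₂_sub, eval₂_pow, eval₂_X, eval₂_C]
        rw [map_natCast]
        linear_combination (1 / 4 : L ℓ) * h4 + (1 / 4 : L ℓ) * hsqL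
    obtain ⟨q, hq⟩ := h ⟨_, hω⟩
    have hq' : a - b * ℓ = (q : ℚ) := by
      have : (a - b * ℓ : ℝ) = q := by
        rw [← hq]
        change _ = 2 * ((z : ℂ) * ((1 + sqrtNegC ℓ) / 2)).re
        rw [hab, show ((a + b * sqrtNegC ℓ) * ((1 + sqrtNegC ℓ) / 2) : ℂ) =
          ((((a - b * ℓ) / 2 : ℚ) : ℝ) : ℂ) + (((a + b) / 2 : ℚ) : ℝ) * sqrtNegC ℓ by
            push_cast; linear_combination (b / 2 : ℂ) * sqrtNegC_mul_self ℓ]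
        simp
        ring
      exact_mod_cast this
    have : sqrtNeg ℓ * z = ((q - p : ℤ) : L ℓ) + (p : L ℓ) * ((1 + sqrtNeg ℓ) / 2) := by
      have e1 : (algebraMap ℚ (L ℓ) a) * 2 = p := by
        have := congrArg (algebraMap ℚ (L ℓ)) hp'
        rw [map_mul] at this
        simp only [map_intCast, map_ofNat] at this
        rw [← this]; ring
      have e2 : (algebraMap ℚ (L ℓ) a) - (algebraMap ℚ (L ℓ) b) * ℓ = q := by
        have := congrArg (algebraMap ℚ (L ℓ)) hq'
        simpa using this
      rw [hzL]
      push_cast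
      linear_combination (algebraMap ℚ (L ℓ) b) * hsqL + e2 +
        (sqrtNeg ℓ / 2 - 1 / 2) * e1
    rw [this]
    exact (hint_int _).add ((hint_int _).mul hω)
  · have hω : IsIntegral ℤ (sqrtNeg ℓ / 2) := by
      refine ⟨X ^ 2 + C (m : ℤ), monic_X_pow_add_C _ two_ne_zero, ?_⟩
      simp only [eval₂_add, eval₂_pow, eval₂_X, eval₂_C]
      have h4 : (ℓ : L ℓ) = 4 * m := by exact_mod_cast congrArg (Nat.cast (R := L ℓ)) hm
      rw [map_natCast]
      linear_combination (-1 / 4 : L ℓ) * h4 + (1 / 4 : L ℓ) * hsqL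
    obtain ⟨q, hq⟩ := h ⟨_, hω⟩
    have hq' : - b * ℓ = (q : ℚ) := by
      have : (- b * ℓ : ℝ) = q := by
        rw [← hq]
        change _ = 2 * ((z : ℂ) * (sqrtNegC ℓ / 2)).re
        rw [hab, show ((a + b * sqrtNegC ℓ) * (sqrtNegC ℓ / 2) : ℂ) =
          ((((- b * ℓ) / 2 : ℚ) : ℝ) : ℂ) + ((a / 2 : ℚ) : ℝ) * sqrtNegC ℓ by
            push_cast; linear_combination (b / 2 : ℂ) * sqrtNegC_mul_self ℓ]
        simp
        ring
      exact_mod_cast this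
    have : sqrtNeg ℓ * z = (q : L ℓ) + (p : L ℓ) * (sqrtNeg ℓ / 2) := by
      have e1 : (algebraMap ℚ (L ℓ) a) * 2 = p := by
        have := congrArg (algebraMap ℚ (L ℓ)) hp'
        rw [map_mul] at this
        simp only [map_intCast, map_ofNat] at this
        rw [← this]; ring
      have e2 : - (algebraMap ℚ (L ℓ) b) * ℓ = q := by
        have := congrArg (algebraMap ℚ (L ℓ)) hq'
        simpa using this
      rw [hzL]
      linear_combination (algebraMap ℚ (L ℓ) b) * hsqL + e2 + (sqrtNeg ℓ / 2) * e1
    rw [this]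
    exact (hint_int _).add ((hint_int _).mul hω)

/-- The norms of `u` and `u⁻¹` are nonnegative integers with product one. -/
theorem normSq_unit (u : (𝓞 (L ℓ))ˣ) :
    Complex.normSq (((u : 𝓞 (L ℓ)) : L ℓ) : ℂ) = 1 := by
  obtain ⟨m, hm⟩ := exists_int_normSq (u : 𝓞 (L ℓ))
  obtain ⟨k, hk⟩ := exists_int_normSq ((u⁻¹ : (𝓞 (L ℓ))ˣ) : 𝓞 (L ℓ))
  have h1 : (m : ℝ) * k = 1 := by
    rw [← hm, ← hk, ← Complex.normSq_mul]
    have : (((u : 𝓞 (L ℓ)) : L ℓ) : ℂ) * (((u⁻¹ : (𝓞 (L ℓ))ˣ) : 𝓞 (L ℓ)) : L ℓ) = 1 := by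
      exact_mod_cast congrArg (fun x : 𝓞 (L ℓ) => ((x : L ℓ) : ℂ)) u.mul_inv
    rw [this, Complex.normSq_one]
  have h2 : m * k = 1 := by exact_mod_cast h1
  have h3 : 0 ≤ m := by
    have := Complex.normSq_nonneg (((u : 𝓞 (L ℓ)) : L ℓ) : ℂ)
    rw [hm] at this
    exact_mod_cast this
  rw [hm]
  rcases Int.mul_eq_one_iff_eq_one_or_neg_one.1 h2 with h | h
  · simp [h.1]
  · omega

/-- A unit is a root of `X² - tX + 1` with `t` an integer and `|t| ≤ 2`. The values `t = ±1` belong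
to primitive third and sixth roots of unity and force `ℓ = 3`; the others give `u² = -1` or `u =
±1`. -/
theorem unit_pow_four (hℓ : IsNegFundamentalDiscriminant ℓ) (h3 : ℓ ≠ 3) (u : (𝓞 (L ℓ))ˣ) :
    (((u : 𝓞 (L ℓ)) : L ℓ) : ℂ) ^ 4 = 1 := by
  obtain ⟨t, ht⟩ := exists_int_two_mul_re (u : 𝓞 (L ℓ))
  have hN := normSq_unit u
  obtain ⟨a, b, hab⟩ := exists_rat_coords ((u : 𝓞 (L ℓ)) : L ℓ)
  set z : ℂ := (((u : 𝓞 (L ℓ)) : L ℓ) : ℂ) with hz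
  have hs := Real.mul_self_sqrt (Nat.cast_nonneg (α := ℝ) ℓ)
  have hre : z.re = a := by rw [hab]; simp
  have him : z.im = b * √ℓ := by rw [hab]; simp
  rw [Complex.normSq_apply] at hN
  have hquad : z ^ 2 = t * z - 1 := by
    have ht' : (t : ℂ) = ((2 * z.re : ℝ) : ℂ) := by rw [ht]; simp
    rw [ht']
    apply Complex.ext
    · simp [pow_two]
      linear_combination -hN
    · simp [pow_two]
      ring
  have hb : t ≤ 2 ∧ -2 ≤ t := by
    have h1 : (t : ℝ) ^ 2 ≤ 4 := by rw [← ht]; nlinarith [mul_self_nonneg z.im]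
    have h2 : t ^ 2 ≤ 4 := by exact_mod_cast h1
    constructor <;> nlinarith
  have hodd : t ^ 2 ≠ 1 := by
    intro ht1
    have hR : (t : ℝ) ^ 2 = 1 := by exact_mod_cast ht1
    have hq : (ℓ : ℚ) * (2 * b) ^ 2 = ((3 : ℤ) : ℚ) := by
      have : (ℓ : ℝ) * (2 * b) ^ 2 = 3 := by
        rw [him] at hN
        rw [← ht] at hR
        linear_combination 4 * hN - hR - (4 * (b : ℝ) ^ 2) * hs
      exact_mod_cast this
    have hsq3 : ∀ s : ℕ, ∀ k : ℤ, (s : ℤ) * k ^ 2 = 3 → s = 3 := by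
      intro s k hk
      have hk1 : k ^ 2 = 1 := by
        have hd : k ^ 2 ∣ 3 := ⟨s, by rw [← hk]; ring⟩
        have := Int.le_of_dvd (by norm_num) hd
        have h0 : k ≠ 0 := by rintro rfl; simp at hk
        have h1 : -1 ≤ k := by nlinarith
        have h2 : k ≤ 1 := by nlinarith
        have : k = -1 ∨ k = 1 := by omega
        rcases this with rfl | rfl <;> norm_num
      rw [hk1] at hk
      omega
    rcases hℓ with ⟨_, hsq⟩ | ⟨m, hm, hm', hsq⟩
    · obtain ⟨k, hk⟩ := exists_int_of_squarefree hsq hq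
      rw [hk] at hq
      exact h3 (hsq3 ℓ k (by exact_mod_cast hq))
    · have hq' : (m : ℚ) * (4 * b) ^ 2 = ((3 : ℤ) : ℚ) := by
        rw [← hq, hm]; push_cast; ring
      obtain ⟨k, hk⟩ := exists_int_of_squarefree hsq hq'
      rw [hk] at hq'
      have := hsq3 m k (by exact_mod_cast hq')
      omega
  have hcases : t = 0 ∨ t = 2 ∨ t = -2 := by
    have : t = -2 ∨ t = -1 ∨ t = 0 ∨ t = 1 ∨ t = 2 := by omega
    rcases this with h | h | h | h | h
    · exact Or.inr (Or.inr h)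
    · exact absurd (by rw [h]; norm_num) hodd
    · exact Or.inl h
    · exact absurd (by rw [h]; norm_num) hodd
    · exact Or.inr (Or.inl h)
  rcases hcases with h | h | h <;> rw [h] at hquad <;> push_cast at hquad
  · linear_combination (z ^ 2 - 1) * hquad
  · have : (z - 1) ^ 2 = 0 := by linear_combination hquad
    have : z = 1 := by simpa [sub_eq_zero] using this
    rw [this]; norm_num
  · have : (z + 1) ^ 2 = 0 := by linear_combination hquad
    have : z = -1 := by simpa [add_eq_zero_iff_eq_neg] using this
    rw [this]; norm_num

end QuadraticField

/-! ### `Λ` as a self-dual `ℤ`-lattice for the trace form. -/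

section Lattice

open Module

variable {ℓ : ℕ} {V : Type*} [AddCommGroup V] [Module (L ℓ) V]
  {h : V →ₗ[L ℓ] V →ₛₗ[conjL ℓ] L ℓ}

theorem form_self_re_pos (hh : IsPosDefHermitian h) {x : V} (hx : x ≠ 0) : 0 < (h x x : ℂ).re :=
  (Complex.pos_iff.1 (hh.pos x hx)).1

theorem form_self_im (hh : IsPosDefHermitian h) (x : V) : (h x x : ℂ).im = 0 := by
  have := congrArg (fun z : L ℓ => (z : ℂ).im) (hh.conj_symm x x)
  simp at this
  linarith

section

variable [Module ℚ V] [IsScalarTower ℚ (L ℓ) V]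

/-- The rational trace form of `h`. -/
def traceForm (h : V →ₗ[L ℓ] V →ₛₗ[conjL ℓ] L ℓ) : V →ₗ[ℚ] V →ₗ[ℚ] ℚ :=
  LinearMap.mk₂ ℚ (fun x y => traceL ℓ (h x y)) (by simp)
    (fun c x y => by
      rw [← algebraMap_smul (L ℓ) c x, map_smul, LinearMap.smul_apply, algebraMap_smul, map_smul])
    (by simp)
    (fun c x y => by
      rw [← algebraMap_smul (L ℓ) c y, LinearMap.map_smulₛₗ,
        show conjL ℓ (algebraMap ℚ (L ℓ) c) = algebraMap ℚ (L ℓ) c by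
          apply Subtype.ext; simp, algebraMap_smul, map_smul])

theorem coe_traceForm (x y : V) : ((traceForm h x y : ℚ) : ℝ) = 2 * (h x y : ℂ).re :=
  coe_traceL _

/-- Positivity makes the trace form nondegenerate, and in finite dimension every rational functional
is then represented by a vector. -/
theorem traceForm_surjective [Module.Finite (L ℓ) V] (hh : IsPosDefHermitian h) :
    Function.Surjective (traceForm h) := by
  have hfin : Module.Finite ℚ V := Module.Finite.trans (L ℓ) V
  have hinj : Function.Injective (traceForm h) := by
    rw [injective_iff_map_eq_zero]
    intro x hx
    by_contra hne
    have h1 := form_self_re_pos hh hne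
    have h2 := coe_traceForm (h := h) x x
    rw [hx] at h2
    simp at h2
    linarith
  exact (LinearMap.injective_iff_surjective_of_finrank_eq_finrank
    (Subspace.dual_finrank_eq (K := ℚ) (V := V)).symm).1 hinj

end

variable [Module (𝓞 (L ℓ)) V] {Λ : Submodule (𝓞 (L ℓ)) V}

theorem exists_sqrtNeg_mul_form
    (hΛ : hermDual h Λ = (fun v : V => sqrtNeg ℓ • v) '' (Λ : Set V)) {x y : V}
    (hx : x ∈ Λ) (hy : y ∈ Λ) : ∃ α : 𝓞 (L ℓ), sqrtNeg ℓ * h x y = α := by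
  have h1 : sqrtNeg ℓ • x ∈ hermDual h Λ := by
    rw [hΛ]
    exact ⟨x, hx, rfl⟩
  obtain ⟨α, hα⟩ := h1 y hy
  refine ⟨α, ?_⟩
  rw [map_smul, LinearMap.smul_apply, smul_eq_mul] at hα
  exact hα

theorem exists_int_two_mul_re_form (hℓ : IsNegFundamentalDiscriminant ℓ)
    (hΛ : hermDual h Λ = (fun v : V => sqrtNeg ℓ • v) '' (Λ : Set V)) {x y : V}
    (hx : x ∈ Λ) (hy : y ∈ Λ) : ∃ n : ℤ, 2 * (h x y : ℂ).re = n := by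
  obtain ⟨α, hα⟩ := exists_sqrtNeg_mul_form hΛ hx hy
  exact exists_int_trace_of_sqrtNeg_mul hℓ hα

variable [IsScalarTower (𝓞 (L ℓ)) (L ℓ) V]

/-- `√(-ℓ)` as an algebraic integer. -/
def sqrtNegInt (ℓ : ℕ) : 𝓞 (L ℓ) :=
  ⟨sqrtNeg ℓ, (isIntegral_algHom_iff ((L ℓ).val.restrictScalars ℤ)
    (L ℓ).val.toRingHom.injective).1 (isIntegral_sqrtNegC ℓ)⟩

@[simp]
theorem coe_sqrtNegInt : ((sqrtNegInt ℓ : 𝓞 (L ℓ)) : L ℓ) = sqrtNeg ℓ := rfl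

/-- Complex conjugation on the ring of integers of `L`. -/
def conjInt (α : 𝓞 (L ℓ)) : 𝓞 (L ℓ) :=
  ⟨conjL ℓ (α : L ℓ), (isIntegral_algHom_iff ((L ℓ).val.restrictScalars ℤ)
    (L ℓ).val.toRingHom.injective).1 (isIntegral_conj (isIntegral_coe α))⟩

@[simp]
theorem coe_conjInt (α : 𝓞 (L ℓ)) : ((conjInt α : 𝓞 (L ℓ)) : L ℓ) = conjL ℓ (α : L ℓ) := rfl

theorem conjL_conjL (z : L ℓ) : conjL ℓ (conjL ℓ z) = z := by
  apply Subtype.ext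
  simp

theorem coe_smul_eq (α : 𝓞 (L ℓ)) (x : V) : (α : L ℓ) • x = α • x := by
  rw [← IsScalarTower.algebraMap_smul (L ℓ) α x]

theorem sqrtNeg_smul_mem {x : V} (hx : x ∈ Λ) : sqrtNeg ℓ • x ∈ Λ := by
  rw [← coe_sqrtNegInt, coe_smul_eq]
  exact Λ.smul_mem _ hx

theorem sqrtNeg_ne_zero (hℓ : IsNegFundamentalDiscriminant ℓ) : sqrtNeg ℓ ≠ 0 := by
  intro h0
  have h1 := sqrtNegC_mul_self ℓ
  have h2 : sqrtNegC ℓ = 0 := by rw [← coe_sqrtNeg, h0]; rfl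
  rw [h2] at h1
  have := hℓ.pos
  simp at h1
  omega

/-- The trace dual of `Λ` lies in `Λ`. Replacing `x` by `conj(α) x` shows that `h(v, x)` pairs
integrally with all of `O_L`, so it lies in the inverse different; thus `√(-ℓ) v` is in the
Hermitian dual `√(-ℓ) Λ`. -/
theorem mem_of_forall_two_mul_re_form (hℓ : IsNegFundamentalDiscriminant ℓ)
    (hΛ : hermDual h Λ = (fun v : V => sqrtNeg ℓ • v) '' (Λ : Set V)) {v : V}
    (hv : ∀ x ∈ Λ, ∃ n : ℤ, 2 * (h v x : ℂ).re = n) : v ∈ Λ := by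
  have h1 : sqrtNeg ℓ • v ∈ hermDual h Λ := by
    intro x hx
    obtain ⟨α, hα⟩ := exists_sqrtNeg_mul_eq_of_trace hℓ (z := h v x) (fun α => by
      obtain ⟨n, hn⟩ := hv _ (Λ.smul_mem (conjInt α) hx)
      refine ⟨n, ?_⟩
      rw [← hn, ← coe_smul_eq, LinearMap.map_smulₛₗ, coe_conjInt, conjL_conjL, smul_eq_mul,
        mul_comm (h v x)])
    refine ⟨α, ?_⟩
    rw [map_smul, LinearMap.smul_apply, smul_eq_mul]
    exact hα
  rw [hΛ] at h1
  obtain ⟨w, hw, hwv⟩ := h1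
  have : w = v := by
    have := congrArg (fun u => (sqrtNeg ℓ)⁻¹ • u) hwv
    simpa [smul_smul, inv_mul_cancel₀ (sqrtNeg_ne_zero hℓ)] using this
  rwa [← this]

section

variable [Module ℚ V] [IsScalarTower ℚ (L ℓ) V]

/-- `Λ` is stable under `√(-ℓ)`, so its rational span is already an `L`-subspace. -/
theorem span_rat_eq_top (hsp : Submodule.span (L ℓ) (Λ : Set V) = ⊤) :
    Submodule.span ℚ (Λ : Set V) = ⊤ := by
  rw [Submodule.eq_top_iff']
  intro x
  suffices H : ∀ z : L ℓ, z • x ∈ Submodule.span ℚ (Λ : Set V) by simpa using H 1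
  have hx : x ∈ Submodule.span (L ℓ) (Λ : Set V) := by rw [hsp]; trivial
  induction hx using Submodule.span_induction with
  | mem x hx =>
    intro z
    obtain ⟨a, b, hab⟩ := exists_rat_coords z
    have hzL : z = (algebraMap ℚ (L ℓ) a) + (algebraMap ℚ (L ℓ) b) * sqrtNeg ℓ := by
      apply Subtype.ext
      simpa using hab
    rw [hzL, add_smul, mul_smul, algebraMap_smul, algebraMap_smul]
    exact add_mem (Submodule.smul_mem _ _ (Submodule.subset_span hx))
      (Submodule.smul_mem _ _ (Submodule.subset_span (sqrtNeg_smul_mem hx)))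
  | zero => intro z; simp
  | add x y _ _ hx hy => intro z; rw [smul_add]; exact add_mem (hx z) (hy z)
  | smul a x _ hx => intro z; rw [smul_smul]; exact hx _

end

/-- Self-duality in the form used for Poisson summation. Pairing with `B` maps `Λ` to `ℤ^N`; it is
injective by positivity and surjective because `Λ` contains its trace dual, so standard vectors pull
back to a dual basis. -/
theorem exists_int_dual_bases [Module.Finite (L ℓ) V] [Submodule.IsLattice (L ℓ) Λ]
    (hℓ : IsNegFundamentalDiscriminant ℓ) (hh : IsPosDefHermitian h)
    (hΛ : hermDual h Λ = (fun v : V => sqrtNeg ℓ • v) '' (Λ : Set V)) :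
    ∃ (N : ℕ) (B B' : Basis (Fin N) ℤ Λ), ∀ i j,
      2 * (h (B' i : V) (B j : V) : ℂ).re = if i = j then 1 else 0 := by
  let _ : Module ℚ V := Module.compHom V (algebraMap ℚ (L ℓ))
  have : IsScalarTower ℚ (L ℓ) V := IsScalarTower.of_algebraMap_smul fun _ _ => rfl
  have : Module.Finite (𝓞 (L ℓ)) Λ := Submodule.IsLattice.finite (L ℓ) Λ
  have : Module.Finite ℤ Λ := Module.Finite.trans (𝓞 (L ℓ)) Λ
  let ΛZ : Submodule ℤ V := Λ.restrictScalars ℤ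
  have : Submodule.IsLattice ℚ ΛZ :=
    ⟨Module.Finite.iff_fg.1 (inferInstanceAs (Module.Finite ℤ Λ)),
      span_rat_eq_top Submodule.IsLattice.span_eq_top⟩
  have : Module.Free ℤ ΛZ := Submodule.IsLattice.free ℚ ΛZ
  have : Module.Free ℤ Λ := inferInstanceAs (Module.Free ℤ ΛZ)
  set N := finrank ℤ Λ
  let B : Basis (Fin N) ℤ Λ := finBasis ℤ Λ
  let Bq : Basis (Fin N) ℚ V := Basis.extendOfIsLattice ℚ (M := ΛZ) B
  have hBq : ∀ i, Bq i = (B i : V) := fun i => Basis.extendOfIsLattice_apply ℚ (M := ΛZ) B i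
  have hint : ∀ x : Λ, ∀ j, ∃ n : ℤ, 2 * (h (x : V) (B j : V) : ℂ).re = n := fun x j =>
    exists_int_two_mul_re_form hℓ hΛ x.2 (B j).2
  choose D hD using hint
  have hadd : ∀ x y, D (x + y) = D x + D y := by
    intro x y
    ext j
    have := hD (x + y) j
    rw [Submodule.coe_add, map_add, LinearMap.add_apply, AddMemClass.coe_add, Complex.add_re,
      mul_add, hD, hD] at this
    exact_mod_cast this.symm
  let Dl : Λ →ₗ[ℤ] (Fin N → ℤ) := (AddMonoidHom.mk' D hadd).toIntLinearMap
  have hDl : ∀ x, Dl x = D x := fun _ => rfl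
  have hext : ∀ (v : V) (f : Fin N → ℤ), (∀ j, 2 * (h v (B j : V) : ℂ).re = f j) →
      ∀ x : Λ, 2 * (h v (x : V) : ℂ).re = ((∑ j, B.repr x j * f j : ℤ) : ℝ) := by
    intro v f hf x
    conv_lhs => rw [← B.sum_repr x]
    rw [Submodule.coe_sum, map_sum]
    simp only [AddSubmonoidClass.coe_finsetSum, Complex.re_sum, Finset.mul_sum, Int.cast_sum,
      Int.cast_mul, ← hf]
    refine Finset.sum_congr rfl fun j _ => ?_
    rw [Submodule.coe_smul_of_tower, map_zsmul, zsmul_eq_mul]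
    simp
    ring
  have hinj : Function.Injective Dl := by
    rw [injective_iff_map_eq_zero]
    intro x hx
    have h1 := hext x 0 (fun j => by rw [hD, ← hDl, hx]) x
    simp at h1
    by_contra hne
    have := form_self_re_pos hh (x := (x : V)) (by simpa using hne)
    linarith
  have hsurj : Function.Surjective Dl := by
    intro f
    -- A rational vector with the prescribed pairings exists first; it lies in `Λ` because its
    -- pairings with all of `Λ` are integers.
    obtain ⟨v, hv⟩ := traceForm_surjective hh (Bq.constr ℚ fun j => (f j : ℚ))
    have hvf : ∀ j, 2 * (h v (B j : V) : ℂ).re = f j := by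
      intro j
      rw [← coe_traceForm, hv, ← hBq, Basis.constr_basis]
      simp
    have hvΛ : v ∈ Λ := mem_of_forall_two_mul_re_form hℓ hΛ
      fun x hx => ⟨_, hext v f hvf ⟨x, hx⟩⟩
    refine ⟨⟨v, hvΛ⟩, ?_⟩
    ext j
    have h1 := hD ⟨v, hvΛ⟩ j
    rw [hvf] at h1
    exact_mod_cast h1.symm
  let De := LinearEquiv.ofBijective Dl ⟨hinj, hsurj⟩
  refine ⟨N, B, Basis.ofEquivFun De, fun i j => ?_⟩
  rw [hD, ← hDl, show Dl (Basis.ofEquivFun De i) = De (Basis.ofEquivFun De i) from rfl,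
    Basis.coe_ofEquivFun, LinearEquiv.apply_symm_apply, Pi.single_apply]
  simp [eq_comm]

end Lattice

/-! ### Realizing `(V, 2h)` inside the standard Hermitian space `ℂ^d`. -/

section Embedding

open Module

open scoped MatrixOrder Matrix.Norms.L2Operator in
theorem exists_eq_conjTranspose_mul_self {m : Type*} [Fintype m] [DecidableEq m]
    {A : Matrix m m ℂ} (hA : A.PosSemidef) : ∃ B : Matrix m m ℂ, A = Bᴴ * B :=
  CStarAlgebra.nonneg_iff_eq_star_mul_self.mp hA.nonneg

/-- Needed to carry positivity of `h` from `L`-coordinates to complex coordinates. -/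
theorem denseRange_coe_L {ℓ : ℕ} (hℓ : IsNegFundamentalDiscriminant ℓ) :
    DenseRange ((↑) : L ℓ → ℂ) := by
  have h1 : DenseRange (Prod.map ((↑) : ℚ → ℝ) ((↑) : ℚ → ℝ)) :=
    Rat.denseRange_cast.prodMap Rat.denseRange_cast
  have hs : √(ℓ : ℝ) ≠ 0 := by
    rw [Real.sqrt_ne_zero']
    exact_mod_cast hℓ.pos
  have h2 : Function.Surjective fun p : ℝ × ℝ => (p.1 : ℂ) + p.2 * sqrtNegC ℓ := by
    intro z
    refine ⟨(z.re, z.im / √ℓ), ?_⟩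
    apply Complex.ext
    · simp
    · simp [hs]
  have h3 := h2.denseRange.comp h1 (by fun_prop)
  refine h3.mono ?_
  rintro _ ⟨⟨a, b⟩, rfl⟩
  exact ⟨algebraMap ℚ (L ℓ) a + algebraMap ℚ (L ℓ) b * sqrtNeg ℓ, by simp⟩

variable {ℓ : ℕ} {V : Type*} [AddCommGroup V] [Module (L ℓ) V]
  {h : V →ₗ[L ℓ] V →ₛₗ[conjL ℓ] L ℓ}

/-- A Hermitian space over `L` embeds into `ℂ^d`, `d = dim V`, such that `2 h` becomes the
standard Hermitian form. -/
theorem exists_embedding [Module.Finite (L ℓ) V]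
    (hℓ : IsNegFundamentalDiscriminant ℓ) (hh : IsPosDefHermitian h) :
    ∃ φ : V →ₗ[L ℓ] (Fin (finrank (L ℓ) V) → ℂ),
      (∀ x y, φ x ⬝ᵥ star (φ y) = 2 * (h x y : ℂ)) ∧
      Submodule.span ℂ (Set.range φ) = ⊤ := by
  set d := finrank (L ℓ) V
  let v : Basis (Fin d) (L ℓ) V := finBasis (L ℓ) V
  let G0 : Matrix (Fin d) (Fin d) (L ℓ) := Matrix.of fun i j => h (v i) (v j)
  let G : Matrix (Fin d) (Fin d) ℂ := G0.map (algebraMap (L ℓ) ℂ)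
  have hexp : ∀ x y : V, (h x y : ℂ) =
      ∑ i, ∑ j, (v.repr x i : ℂ) * (starRingEnd ℂ (v.repr y j : ℂ)) * G i j := by
    intro x y
    have : h x y = ∑ i, ∑ j, v.repr x i * (conjL ℓ (v.repr y j)) * G0 i j := by
      conv_lhs => rw [← v.sum_repr x, ← v.sum_repr y]
      simp only [map_sum, LinearMap.sum_apply, map_smul, LinearMap.smul_apply,
        LinearMap.map_smulₛₗ, smul_eq_mul, Finset.mul_sum]
      rw [Finset.sum_comm]
      refine Finset.sum_congr rfl fun i _ => Finset.sum_congr rfl fun j _ => by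
        simp only [G0, Matrix.of_apply]
        ring
    rw [this]
    simp [G]
  have hGh : G.IsHermitian := by
    ext i j
    simp only [conjTranspose_apply, G, map_apply, G0, of_apply]
    rw [show algebraMap (L ℓ) ℂ (h (v i) (v j)) = starRingEnd ℂ (h (v j) (v i) : ℂ) from
      congrArg (fun z : L ℓ => (z : ℂ)) (hh.conj_symm (v j) (v i))]
    rfl
  have hnn : ∀ x : V, 0 ≤ (h x x : ℂ) := by
    intro x
    rcases eq_or_ne x 0 with rfl | hx
    · simp
    · exact (hh.pos x hx).le
  have hpsd : G.PosSemidef := by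
    refine PosSemidef.of_dotProduct_mulVec_nonneg hGh ?_
    have hd : DenseRange (Pi.map fun _ : Fin d => ((↑) : L ℓ → ℂ)) :=
      DenseRange.piMap fun _ => denseRange_coe_L hℓ
    have hcl : IsClosed {c : Fin d → ℂ | 0 ≤ star c ⬝ᵥ (G *ᵥ c)} := by
      refine isClosed_le continuous_const ?_
      exact Continuous.dotProduct (by fun_prop) (by fun_prop)
    intro c
    refine hd.induction_on (p := fun c => 0 ≤ star c ⬝ᵥ (G *ᵥ c)) c hcl fun w => ?_
    -- Conjugated coordinates, because `h` is linear in its first argument whereas `star c ⬝ᵥ (G *ᵥ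
    -- c)` conjugates the first factor.
    let x : V := ∑ i, conjL ℓ (w i) • v i
    have hx : ∀ i, v.repr x i = conjL ℓ (w i) := by
      intro i
      simp [x, Finsupp.single_apply]
    have h1 := hnn x
    rw [hexp] at h1
    convert! h1 using 1
    simp only [dotProduct, mulVec, hx, coe_conjL, Finset.mul_sum, Pi.star_apply, Pi.map_apply]
    refine Finset.sum_congr rfl fun i _ => Finset.sum_congr rfl fun j _ => ?_
    simp
    ring
  -- Density yields only semidefiniteness. Nondegeneracy is checked over `L`, where a kernel vector
  -- would be a nonzero `x` with `h(x, x) = 0`.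
  have hdet : G.det ≠ 0 := by
    have h1 : G.det = algebraMap (L ℓ) ℂ G0.det := (RingHom.map_det _ _).symm
    rw [h1, Ne, map_eq_zero]
    intro h0
    obtain ⟨w, hw0, hw⟩ := Matrix.exists_mulVec_eq_zero_iff.2 h0
    let x : V := ∑ i, conjL ℓ (w i) • v i
    have hhx : ∀ i, h (v i) x = 0 := by
      intro i
      have := congrFun hw i
      simp only [x, map_sum, LinearMap.map_smulₛₗ, conjL_conjL, smul_eq_mul]
      refine Eq.trans ?_ this
      simp only [mulVec, dotProduct, G0, of_apply]
      refine Finset.sum_congr rfl fun j _ => by simp [mul_comm]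
    have hx0 : x = 0 := by
      by_contra hne
      have h2 := hh.pos x hne
      have e : h x x = ∑ i, v.repr x i * h (v i) x := by
        nth_rewrite 1 [← v.sum_repr x]
        simp only [map_sum, LinearMap.sum_apply, map_smul, LinearMap.smul_apply, smul_eq_mul]
      rw [e] at h2
      simp [hhx] at h2
    apply hw0
    ext i
    have hx : v.repr x i = conjL ℓ (w i) := by
      simp [x, Finsupp.single_apply]
    rw [hx0] at hx
    have := congrArg (conjL ℓ) hx
    rw [conjL_conjL] at this
    simp at this
    simp [← this]
  -- Factoring `2G` instead of `G` makes the Euclidean inner product equal to `2 Re h`, the form for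
  -- which `Λ` is self-dual.
  obtain ⟨B, hB⟩ := exists_eq_conjTranspose_mul_self
    (hpsd.smul (show (0 : ℂ) ≤ 2 by norm_num))
  have hBe : ∀ i j, ∑ k, starRingEnd ℂ (B k i) * B k j = 2 * G i j := by
    intro i j
    have := congrFun (congrFun hB i) j
    simp only [mul_apply, conjTranspose_apply, Matrix.smul_apply, smul_eq_mul] at this
    exact this.symm
  let φ : V →ₗ[L ℓ] (Fin d → ℂ) :=
    { toFun := fun x k => ∑ i, (v.repr x i : ℂ) * starRingEnd ℂ (B k i)
      map_add' := fun x y => by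
        ext k; simp [add_mul, Finset.sum_add_distrib]
      map_smul' := fun c x => by
        ext k
        simp [Finset.mul_sum, mul_assoc, IntermediateField.smul_def] }
  have hφ : ∀ x k, φ x k = ∑ i, (v.repr x i : ℂ) * starRingEnd ℂ (B k i) := fun _ _ => rfl
  refine ⟨φ, ?_, ?_⟩
  · intro x y
    rw [hexp]
    simp only [dotProduct, hφ, Pi.star_apply, RCLike.star_def, map_sum, map_mul,
      Complex.conj_conj, Finset.sum_mul_sum]
    rw [Finset.sum_comm, Finset.mul_sum]
    refine Finset.sum_congr rfl fun i _ => ?_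
    rw [Finset.sum_comm, Finset.mul_sum]
    refine Finset.sum_congr rfl fun j _ => ?_
    rw [mul_left_comm, ← hBe, Finset.mul_sum]
    refine Finset.sum_congr rfl fun k _ => ?_
    ring
  · have hBd : B.det ≠ 0 := by
      intro h0
      have := congrArg Matrix.det hB
      rw [det_mul, h0, mul_zero, det_smul] at this
      simp [hdet] at this
    have hu : IsUnit Bᴴ := by
      rw [Matrix.isUnit_iff_isUnit_det, det_conjTranspose]
      simpa using hBd
    have hli := Matrix.linearIndependent_rows_of_isUnit hu
    have hφv : ∀ i, φ (v i) = Bᴴ.row i := by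
      intro i
      ext k
      simp only [hφ, v.repr_self, Finsupp.single_apply, Matrix.row, conjTranspose_apply]
      rw [Finset.sum_eq_single i] <;> simp +contextual [eq_comm]
    rw [eq_top_iff, ← hli.span_eq_top_of_card_eq_finrank' (by simp)]
    refine Submodule.span_mono ?_
    rintro _ ⟨i, rfl⟩
    exact ⟨v i, hφv i⟩

end Embedding

/-! ### The lattice `Λ^n` in the Euclidean space `ℂ^(d × n)`. -/

section Coordinates

open Module

/-- The real span is stable under `√(-ℓ)`, hence a complex subspace, and it contains the image of
`V`. -/
theorem span_real_image_eq_top {ℓ d : ℕ} {V : Type*} [AddCommGroup V] [Module (L ℓ) V]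
    [Module (𝓞 (L ℓ)) V] [IsScalarTower (𝓞 (L ℓ)) (L ℓ) V] {Λ : Submodule (𝓞 (L ℓ)) V}
    [Submodule.IsLattice (L ℓ) Λ] (hℓ : IsNegFundamentalDiscriminant ℓ)
    {φ : V →ₗ[L ℓ] (Fin d → ℂ)} (hφ : Submodule.span ℂ (Set.range φ) = ⊤) :
    Submodule.span ℝ (φ '' (Λ : Set V)) = ⊤ := by
  set S := Submodule.span ℝ (φ '' (Λ : Set V)) with hS
  have hmul : ∀ w ∈ S, sqrtNegC ℓ • w ∈ S := by
    intro w hw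
    induction hw using Submodule.span_induction with
    | mem w hw =>
      obtain ⟨x, hx, rfl⟩ := hw
      refine Submodule.subset_span ⟨sqrtNeg ℓ • x, sqrtNeg_smul_mem hx, ?_⟩
      rw [map_smul]
      rfl
    | zero => simp
    | add x y _ _ hx hy => rw [smul_add]; exact add_mem hx hy
    | smul a x _ hx => rw [smul_comm]; exact S.smul_mem _ hx
  have hs : √(ℓ : ℝ) ≠ 0 := by
    rw [Real.sqrt_ne_zero']
    exact_mod_cast hℓ.pos
  have hcmul : ∀ (c : ℂ), ∀ w ∈ S, c • w ∈ S := by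
    intro c w hw
    have hc : c = (c.re : ℂ) + ((c.im / √ℓ : ℝ) : ℂ) * sqrtNegC ℓ := by
      apply Complex.ext
      · simp
      · simp [hs]
    rw [hc, add_smul, mul_smul, Complex.coe_smul, Complex.coe_smul]
    exact add_mem (S.smul_mem _ hw) (S.smul_mem _ (hmul w hw))
  let SC : Submodule ℂ (Fin d → ℂ) := { S with smul_mem' := fun c w hw => hcmul c w hw }
  have hV : ∀ x : V, φ x ∈ SC := by
    intro x
    have hx : x ∈ Submodule.span (L ℓ) (Λ : Set V) := by
      rw [Submodule.IsLattice.span_eq_top]; trivial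
    induction hx using Submodule.span_induction with
    | mem x hx => exact Submodule.subset_span (R := ℝ) ⟨x, hx, rfl⟩
    | zero => simp
    | add x y _ _ hx hy => rw [map_add]; exact add_mem hx hy
    | smul a x _ hx => rw [map_smul]; exact hcmul (a : ℂ) _ hx
  have hle : (⊤ : Submodule ℂ (Fin d → ℂ)) ≤ SC := by
    rw [← hφ, Submodule.span_le]
    rintro _ ⟨x, rfl⟩
    exact hV x
  rw [Submodule.eq_top_iff']
  intro w
  exact hle (Submodule.mem_top (x := w))

/-- The real Euclidean space underlying `d` columns of length `n`. -/
abbrev Cols (d n : ℕ) : Type := EuclideanSpace ℂ (Fin d × Fin n)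

variable {d n : ℕ}

/-- The columns as a tuple of vectors. -/
def colsEquiv (d n : ℕ) : Cols d n ≃ₗ[ℝ] (Fin d → Fin n → ℂ) where
  toFun w k i := w (k, i)
  map_add' _ _ := rfl
  map_smul' _ _ := rfl
  invFun w := WithLp.toLp 2 fun k => w k.1 k.2
  left_inv _ := rfl
  right_inv _ := rfl

/-- Left multiplication of all columns by an invertible matrix. -/
def colsMul (p q : Matrix (Fin n) (Fin n) ℂ) (hpq : p * q = 1) (d : ℕ) :
    Cols d n ≃ₗ[ℝ] Cols d n :=
  (colsEquiv d n).trans (LinearEquiv.trans (LinearEquiv.piCongrRight fun _ : Fin d =>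
    (Matrix.toLin'OfInv (mul_eq_one_comm.1 hpq) hpq).restrictScalars ℝ) (colsEquiv d n).symm)

theorem colsMul_apply (p q : Matrix (Fin n) (Fin n) ℂ) (hpq : p * q = 1) (w : Cols d n)
    (k : Fin d) (i : Fin n) : colsMul p q hpq d w (k, i) = ∑ j, p i j * w (k, j) :=
  rfl

/-- The map is `d` copies of `p`, and the real determinant of a complex-linear map is the squared
modulus of its complex one. -/
theorem det_colsMul (p q : Matrix (Fin n) (Fin n) ℂ) (hpq : p * q = 1) :
    LinearMap.det (colsMul p q hpq d : Cols d n →ₗ[ℝ] Cols d n) = Complex.normSq p.det ^ d := by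
  have h1 : (colsMul p q hpq d : Cols d n →ₗ[ℝ] Cols d n) =
      ((colsEquiv d n).symm : (Fin d → Fin n → ℂ) →ₗ[ℝ] Cols d n) ∘ₗ
      (LinearMap.pi fun i => ((Matrix.toLin' p).restrictScalars ℝ).comp (LinearMap.proj i)) ∘ₗ
      ((colsEquiv d n).symm.symm : Cols d n →ₗ[ℝ] (Fin d → Fin n → ℂ)) := by
    rfl
  rw [h1, LinearMap.det_conj, LinearMap.det_pi, Finset.prod_const, LinearMap.det_restrictScalars,
    LinearMap.det_toLin', Algebra.norm_complex_apply]
  simp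

theorem inner_cols (v w : Cols d n) :
    inner ℝ v w = (∑ k, ∑ i, starRingEnd ℂ (v (k, i)) * w (k, i)).re := by
  rw [PiLp.inner_apply, Fintype.sum_prod_type]
  simp [Complex.inner, mul_comm]

/-- Supplies the pair `(P, Q)` for the Gaussian inversion: `qᴴ` is the inverse adjoint of `p`. -/
theorem inner_colsMul (p q : Matrix (Fin n) (Fin n) ℂ) (hpq : p * q = 1) (v w : Cols d n) :
    inner ℝ (colsMul p q hpq d v) (colsMul qᴴ pᴴ
      (by rw [← conjTranspose_mul, hpq, conjTranspose_one]) d w) = inner ℝ v w := by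
  rw [inner_cols, inner_cols]
  congr 1
  refine Finset.sum_congr rfl fun k _ => ?_
  have h1 : ∀ a b : Fin n → ℂ, star (p *ᵥ a) ⬝ᵥ (qᴴ *ᵥ b) = star a ⬝ᵥ b := by
    intro a b
    rw [star_mulVec, ← dotProduct_mulVec, mulVec_mulVec, ← conjTranspose_mul,
      mul_eq_one_comm.1 hpq, conjTranspose_one, one_mulVec]
  have h2 := h1 (fun i => v (k, i)) (fun i => w (k, i))
  simpa [dotProduct, mulVec, colsMul_apply] using h2

/-- Columns with only the `i`-th row nonzero. -/
def colsSingle (d n : ℕ) (i : Fin n) : (Fin d → ℂ) →ₗ[ℝ] Cols d n where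
  toFun c := WithLp.toLp 2 fun k => if k.2 = i then c k.1 else 0
  map_add' a b := by ext k; by_cases hk : k.2 = i <;> simp [hk]
  map_smul' r a := by ext k; by_cases hk : k.2 = i <;> simp [hk]

theorem sum_colsSingle (w : Cols d n) : ∑ i, colsSingle d n i (fun k => w (k, i)) = w := by
  ext ⟨k, l⟩
  simp [colsSingle]

variable {ℓ : ℕ} {V : Type*} [AddCommGroup V] [Module (L ℓ) V]
  [Module (𝓞 (L ℓ)) V]
  {h : V →ₗ[L ℓ] V →ₛₗ[conjL ℓ] L ℓ} {Λ : Submodule (𝓞 (L ℓ)) V}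

/-- The map `Λ^n → ℂ^(d × n)` induced by `φ : V → ℂ^d`. -/
def latticeCols (φ : V →ₗ[L ℓ] (Fin d → ℂ)) (Λ : Submodule (𝓞 (L ℓ)) V) (n : ℕ) :
    (Fin n → Λ) →ₗ[ℤ] Cols d n :=
  (AddMonoidHom.mk' (fun x => WithLp.toLp 2 fun k => φ (x k.2) k.1) (fun x y => by
    ext k; simp)).toIntLinearMap

theorem latticeCols_apply (φ : V →ₗ[L ℓ] (Fin d → ℂ)) (x : Fin n → Λ) (k : Fin d) (i : Fin n) :
    latticeCols φ Λ n x (k, i) = φ (x i) k := rfl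

/-- With `F` the matrix of rows `φ(x_i)`, the squared norm is `trace(pF(pF)ᴴ)` and `F Fᴴ` is twice
the Gram matrix. This links Gaussians to theta terms at `iY`, `Y = pᴴ p`. -/
theorem norm_sq_colsMul_latticeCols {φ : V →ₗ[L ℓ] (Fin d → ℂ)}
    (hφ : ∀ x y, φ x ⬝ᵥ star (φ y) = 2 * (h x y : ℂ)) (p q : Matrix (Fin n) (Fin n) ℂ)
    (hpq : p * q = 1) (x : Fin n → Λ) :
    ((‖colsMul p q hpq d (latticeCols φ Λ n x)‖ ^ 2 : ℝ) : ℂ) =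
      2 * (gram h (fun i => (x i : V)) * (pᴴ * p)).trace := by
  let F : Matrix (Fin n) (Fin d) ℂ := Matrix.of fun i k => φ (x i) k
  have hF : F * Fᴴ = (2 : ℂ) • gram h (fun i => (x i : V)) := by
    ext i j
    exact hφ (x i) (x j)
  have h1 : 2 * (gram h (fun i => (x i : V)) * (pᴴ * p)).trace = ((p * F) * (p * F)ᴴ).trace := by
    rw [conjTranspose_mul, Matrix.mul_assoc p F, ← Matrix.mul_assoc F, hF, Matrix.smul_mul,
      Matrix.mul_smul, trace_smul, smul_eq_mul, Matrix.trace_mul_comm p, Matrix.mul_assoc]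
  rw [h1, EuclideanSpace.norm_sq_eq, Fintype.sum_prod_type, Finset.sum_comm]
  simp only [trace, diag_apply, Matrix.mul_apply (M := p * F), conjTranspose_apply]
  push_cast
  refine Finset.sum_congr rfl fun i _ => Finset.sum_congr rfl fun k _ => ?_
  rw [RCLike.star_def, Complex.mul_conj, Complex.normSq_eq_norm_sq, colsMul_apply]
  push_cast
  rfl

/-- The inner product conjugates its first argument and `h` its second; real parts do not see the
difference. -/
theorem inner_latticeCols {φ : V →ₗ[L ℓ] (Fin d → ℂ)}
    (hφ : ∀ x y, φ x ⬝ᵥ star (φ y) = 2 * (h x y : ℂ)) (hh : IsPosDefHermitian h)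
    (x y : Fin n → Λ) :
    inner ℝ (latticeCols φ Λ n x) (latticeCols φ Λ n y) =
      ∑ i, 2 * (h (x i : V) (y i : V) : ℂ).re := by
  rw [inner_cols, Finset.sum_comm, Complex.re_sum]
  refine Finset.sum_congr rfl fun i _ => ?_
  have h1 : (h (x i : V) (y i : V) : ℂ).re = (h (y i : V) (x i : V) : ℂ).re := by
    rw [hh.conj_symm (y i : V) (x i : V), coe_conjL, Complex.conj_re]
  have h2 := congrArg Complex.re (hφ (y i) (x i))
  rw [h1, show 2 * (h (y i : V) (x i : V) : ℂ).re = (2 * (h (y i : V) (x i : V) : ℂ)).re by simp,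
    ← h2]
  congr 1
  simp only [dotProduct, latticeCols_apply]
  refine Finset.sum_congr rfl fun k _ => ?_
  rw [mul_comm]
  rfl

variable [IsScalarTower (𝓞 (L ℓ)) (L ℓ) V]

theorem span_latticeCols [Submodule.IsLattice (L ℓ) Λ] (hℓ : IsNegFundamentalDiscriminant ℓ)
    {φ : V →ₗ[L ℓ] (Fin d → ℂ)} (hφ : Submodule.span ℂ (Set.range φ) = ⊤) {ι : Type*}
    [Fintype ι] (B : Basis ι ℤ (Fin n → Λ)) :
    Submodule.span ℝ (Set.range fun i => latticeCols φ Λ n (B i)) = ⊤ := by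
  set S := Submodule.span ℝ (Set.range fun i => latticeCols φ Λ n (B i)) with hS
  have hx : ∀ x, latticeCols φ Λ n x ∈ S := by
    intro x
    rw [← B.sum_repr x, map_sum]
    refine sum_mem fun i _ => ?_
    rw [map_zsmul]
    exact zsmul_mem (Submodule.subset_span (Set.mem_range_self i)) _
  have hc : ∀ i (c : Fin d → ℂ), colsSingle d n i c ∈ S := by
    intro i c
    have hc : c ∈ Submodule.span ℝ (φ '' (Λ : Set V)) := by
      rw [span_real_image_eq_top hℓ hφ]; trivial
    have h1 := Submodule.mem_map_of_mem (f := colsSingle d n i) hc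
    rw [Submodule.map_span] at h1
    refine Submodule.span_le.2 ?_ h1
    rintro _ ⟨_, ⟨y, hy, rfl⟩, rfl⟩
    convert! hx (Pi.single i ⟨y, hy⟩) using 1
    ext ⟨k, l⟩
    rw [latticeCols_apply]
    by_cases hl : l = i
    · subst hl; simp [colsSingle]
    · simp [colsSingle, hl]
  rw [Submodule.eq_top_iff']
  intro w
  rw [← sum_colsSingle w]
  exact sum_mem fun i _ => hc i _

theorem exists_selfDual_bases [Module.Finite (L ℓ) V] [Submodule.IsLattice (L ℓ) Λ]
    (hℓ : IsNegFundamentalDiscriminant ℓ) (hh : IsPosDefHermitian h)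
    (hΛ : hermDual h Λ = (fun v : V => sqrtNeg ℓ • v) '' (Λ : Set V))
    {φ : V →ₗ[L ℓ] (Fin d → ℂ)} (hφ : ∀ x y, φ x ⬝ᵥ star (φ y) = 2 * (h x y : ℂ)) (n : ℕ) :
    ∃ (N : ℕ) (B B' : Basis (Σ _ : Fin n, Fin N) ℤ (Fin n → Λ)), ∀ i j,
      inner ℝ (latticeCols φ Λ n (B' i)) (latticeCols φ Λ n (B j)) =
        if i = j then (1 : ℝ) else 0 := by
  obtain ⟨N, B, B', hB⟩ := exists_int_dual_bases hℓ hh hΛ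
  refine ⟨N, Pi.basis fun _ => B, Pi.basis fun _ => B', ?_⟩
  rintro ⟨i, j⟩ ⟨i', j'⟩
  rw [inner_latticeCols hφ hh, Pi.basis_apply, Pi.basis_apply]
  rw [Finset.sum_eq_single i]
  · by_cases hi : i = i'
    · subst hi
      simp [hB]
    · simp [hi]
  · intro l _ hl
    simp [hl]
  · simp

end Coordinates

/-! ### Bounds for positive definite Hermitian matrices. -/

section PosDef

variable {m : Type*} [Fintype m]

theorem norm_trace_mul_le {G D : Matrix m m ℂ} {T r : ℝ} (hG : ∀ i j, ‖G i j‖ ≤ T)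
    (hD : ∀ i j, ‖D i j‖ ≤ r) : ‖(G * D).trace‖ ≤ (Fintype.card m) ^ 2 * r * T := by
  simp only [trace, diag_apply, mul_apply]
  calc _ ≤ ∑ i : m, ∑ j : m, ‖G i j * D j i‖ :=
        (norm_sum_le _ _).trans (Finset.sum_le_sum fun i _ => norm_sum_le _ _)
    _ ≤ ∑ i : m, ∑ j : m, T * r := by
        refine Finset.sum_le_sum fun i _ => Finset.sum_le_sum fun j _ => ?_
        rw [norm_mul]
        have hT : 0 ≤ T := (norm_nonneg _).trans (hG i j)
        exact mul_le_mul (hG i j) (hD j i) (norm_nonneg _) hT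
    _ = _ := by simp; ring

variable [DecidableEq m]

theorem re_trace_mul_nonneg {A B : Matrix m m ℂ} (hA : A.PosSemidef) (hB : B.PosSemidef) :
    0 ≤ (A * B).trace.re := by
  obtain ⟨C, rfl⟩ := exists_eq_conjTranspose_mul_self hA
  rw [Matrix.mul_assoc, Matrix.trace_mul_comm]
  exact (Complex.nonneg_iff.1 (hB.mul_mul_conjTranspose_same C).trace_nonneg).1

/-- Take `ε` to be the smallest eigenvalue; for the empty matrix any positive number serves. -/
theorem exists_pos_sub_smul_one_posSemidef {Y : Matrix m m ℂ} (hY : Y.PosDef) :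
    ∃ ε : ℝ, 0 < ε ∧ (Y - (ε : ℂ) • (1 : Matrix m m ℂ)).PosSemidef := by
  obtain ⟨ε, hε, hle⟩ : ∃ ε : ℝ, 0 < ε ∧ ∀ i, ε ≤ hY.1.eigenvalues i := by
    rcases isEmpty_or_nonempty m with he | he
    · exact ⟨1, one_pos, fun i => he.elim i⟩
    · obtain ⟨i, hi⟩ := Finite.exists_min hY.1.eigenvalues
      exact ⟨_, hY.eigenvalues_pos i, hi⟩
  refine ⟨ε, hε, ?_⟩
  set U : Matrix m m ℂ := (hY.1.eigenvectorUnitary : Matrix m m ℂ) with hU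
  have h1 : Y = U * Matrix.diagonal (fun i => (hY.1.eigenvalues i : ℂ)) * Uᴴ := by
    conv_lhs => rw [hY.1.spectral_theorem]
    rfl
  have h2 : U * Uᴴ = 1 := Unitary.coe_mul_star_self hY.1.eigenvectorUnitary
  have h3 : Y - (ε : ℂ) • (1 : Matrix m m ℂ) =
      U * Matrix.diagonal (fun i => ((hY.1.eigenvalues i - ε : ℝ) : ℂ)) * Uᴴ := by
    have : Matrix.diagonal (fun i => ((hY.1.eigenvalues i - ε : ℝ) : ℂ)) =
        Matrix.diagonal (fun i => (hY.1.eigenvalues i : ℂ)) - (ε : ℂ) • (1 : Matrix m m ℂ) := by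
      rw [← diagonal_one, ← diagonal_smul, diagonal_sub]
      congr 1
      ext i
      simp
    rw [this, Matrix.mul_sub, Matrix.sub_mul, ← h1]
    simp [h2]
  rw [h3]
  refine (PosSemidef.diagonal fun i => ?_).mul_mul_conjTranspose_same U
  simpa using hle i

theorem exists_eq_conjTranspose_mul_self_of_posDef {Y : Matrix m m ℂ} (hY : Y.PosDef) :
    ∃ p q : Matrix m m ℂ, p * q = 1 ∧ Y = pᴴ * p := by
  obtain ⟨p, hp⟩ := exists_eq_conjTranspose_mul_self hY.posSemidef
  refine ⟨p, p⁻¹, mul_nonsing_inv p ?_, hp⟩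
  have h1 := hY.det_pos.ne'
  rw [hp, det_mul] at h1
  exact isUnit_iff_ne_zero.2 (right_ne_zero_of_mul h1)

end PosDef

/-! ### Convergence of the series and inversion at `Z = iY`. -/

section Theta

open Module

variable {ℓ d n : ℕ} {V : Type*} [AddCommGroup V] [Module (L ℓ) V]
  {h : V →ₗ[L ℓ] V →ₛₗ[conjL ℓ] L ℓ}

theorem gram_isHermitian (hh : IsPosDefHermitian h) (x : Fin n → V) : (gram h x).IsHermitian := by
  ext i j
  exact congrArg (fun z : L ℓ => (z : ℂ)) (hh.conj_symm (x j) (x i)).symm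

theorem norm_thetaTerm (Z : Matrix (Fin n) (Fin n) ℂ) (x : Fin n → V) :
    ‖thetaTerm h Z x‖ = Real.exp (-(2 * Real.pi * (gram h x * Z).trace.im)) := by
  rw [thetaTerm, Complex.norm_exp]
  congr 1
  simp [mul_assoc]

/-- As the Gram matrix is Hermitian, replacing `Z` by `Zᴴ` conjugates the trace. -/
theorem trace_gram_mul_imPart (hh : IsPosDefHermitian h) (Z : Matrix (Fin n) (Fin n) ℂ)
    (x : Fin n → V) : (gram h x * Z).trace.im = (gram h x * imPart Z).trace.re := by
  have h1 : (gram h x * Zᴴ).trace = starRingEnd ℂ (gram h x * Z).trace := by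
    rw [starRingEnd_apply, ← trace_conjTranspose, conjTranspose_mul, gram_isHermitian hh x,
      Matrix.trace_mul_comm]
  rw [imPart, Matrix.mul_smul, trace_smul, Matrix.mul_sub, trace_sub, h1, Complex.sub_conj,
    smul_eq_mul]
  have : (2 * Complex.I)⁻¹ * ((2 * (gram h x * Z).trace.im : ℝ) * Complex.I) =
      ((gram h x * Z).trace.im : ℂ) := by
    push_cast
    field_simp
  rw [this, Complex.ofReal_re]

theorem two_smul_gram {φ : V →ₗ[L ℓ] (Fin d → ℂ)}
    (hφ : ∀ x y, φ x ⬝ᵥ star (φ y) = 2 * (h x y : ℂ)) (x : Fin n → V) :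
    (2 : ℂ) • gram h x = (Matrix.of fun i k => φ (x i) k) * (Matrix.of fun i k => φ (x i) k)ᴴ := by
  ext i j
  exact (hφ (x i) (x j)).symm

theorem gram_posSemidef {φ : V →ₗ[L ℓ] (Fin d → ℂ)}
    (hφ : ∀ x y, φ x ⬝ᵥ star (φ y) = 2 * (h x y : ℂ)) (x : Fin n → V) :
    (gram h x).PosSemidef := by
  have h1 := posSemidef_self_mul_conjTranspose (Matrix.of fun i k => φ (x i) k)
  rw [← two_smul_gram hφ x] at h1
  have h2 := h1.smul (show (0 : ℂ) ≤ 2⁻¹ by rw [Complex.nonneg_iff]; norm_num)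
  rwa [smul_smul, inv_mul_cancel₀ two_ne_zero, one_smul] at h2

/-- Twice the Gram matrix is `F Fᴴ`, so `2|ab| ≤ |a|² + |b|²` bounds each entry by the trace.
Convergence is thereby controlled by the trace alone. -/
theorem norm_gram_le {φ : V →ₗ[L ℓ] (Fin d → ℂ)}
    (hφ : ∀ x y, φ x ⬝ᵥ star (φ y) = 2 * (h x y : ℂ)) (x : Fin n → V) (i j : Fin n) :
    ‖gram h x i j‖ ≤ (gram h x).trace.re := by
  set F : Matrix (Fin n) (Fin d) ℂ := Matrix.of fun i k => φ (x i) k with hF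
  have hG : ∀ i j, 2 * gram h x i j = ∑ k, F i k * starRingEnd ℂ (F j k) := fun i j =>
    congrFun (congrFun (two_smul_gram hφ x) i) j
  have hT : 2 * (gram h x).trace.re = ∑ l, ∑ k, ‖F l k‖ ^ 2 := by
    have h1 : 2 * (gram h x).trace = ∑ l, ∑ k, ((‖F l k‖ ^ 2 : ℝ) : ℂ) := by
      rw [trace, Finset.mul_sum]
      refine Finset.sum_congr rfl fun l _ => ?_
      rw [diag_apply, hG]
      refine Finset.sum_congr rfl fun k _ => ?_
      rw [Complex.mul_conj, Complex.normSq_eq_norm_sq]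
    have h2 := congrArg Complex.re h1
    simpa only [Complex.re_sum, Complex.ofReal_re, Complex.mul_re, Complex.re_ofNat,
      Complex.im_ofNat, zero_mul, sub_zero] using h2
  have h2 : 2 * ‖gram h x i j‖ ≤ ∑ l, ∑ k, ‖F l k‖ ^ 2 := by
    calc 2 * ‖gram h x i j‖ = ‖2 * gram h x i j‖ := by simp
      _ ≤ ∑ k, ‖F i k‖ * ‖F j k‖ := by
        rw [hG]
        refine (norm_sum_le _ _).trans (Finset.sum_le_sum fun k _ => ?_)
        rw [norm_mul, RCLike.norm_conj]
      _ ≤ ∑ k, ∑ l, ‖F l k‖ ^ 2 := by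
        refine Finset.sum_le_sum fun k _ => ?_
        have h3 : ∀ i, ‖F i k‖ ^ 2 ≤ ∑ l, ‖F l k‖ ^ 2 := fun i =>
          Finset.single_le_sum (f := fun l => ‖F l k‖ ^ 2) (fun l _ => by positivity)
            (Finset.mem_univ i)
        nlinarith [h3 i, h3 j, sq_nonneg (‖F i k‖ - ‖F j k‖)]
      _ = _ := Finset.sum_comm
  linarith

variable [Module (𝓞 (L ℓ)) V] {Λ : Submodule (𝓞 (L ℓ)) V}

theorem norm_sq_latticeCols {φ : V →ₗ[L ℓ] (Fin d → ℂ)}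
    (hφ : ∀ x y, φ x ⬝ᵥ star (φ y) = 2 * (h x y : ℂ)) (x : Fin n → Λ) :
    ‖latticeCols φ Λ n x‖ ^ 2 = 2 * (gram h (fun i => (x i : V))).trace.re := by
  have h1 := norm_sq_colsMul_latticeCols hφ 1 1 (one_mul 1) x
  have h2 : colsMul 1 1 (one_mul (1 : Matrix (Fin n) (Fin n) ℂ)) d (latticeCols φ Λ n x) =
      latticeCols φ Λ n x := by
    ext ⟨k, i⟩
    rw [colsMul_apply]
    simp [Matrix.one_apply]
  rw [h2, conjTranspose_one, Matrix.mul_one, Matrix.mul_one] at h1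
  have h3 := congrArg Complex.re h1
  rw [Complex.ofReal_re] at h3
  rw [h3]
  simp

theorem thetaTerm_I_smul {φ : V →ₗ[L ℓ] (Fin d → ℂ)}
    (hφ : ∀ x y, φ x ⬝ᵥ star (φ y) = 2 * (h x y : ℂ)) (p q : Matrix (Fin n) (Fin n) ℂ)
    (hpq : p * q = 1) (x : Fin n → Λ) :
    thetaTerm h (Complex.I • (pᴴ * p)) (fun i => (x i : V)) =
      ((Real.exp (-Real.pi * ‖colsMul p q hpq d (latticeCols φ Λ n x)‖ ^ 2) : ℝ) : ℂ) := by
  have h1 := norm_sq_colsMul_latticeCols hφ p q hpq x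
  rw [thetaTerm, Complex.ofReal_exp]
  congr 1
  rw [Matrix.mul_smul, trace_smul, smul_eq_mul, Complex.ofReal_mul, h1]
  push_cast
  linear_combination (2 * Real.pi * (gram h (fun i => (x i : V)) * (pᴴ * p)).trace : ℂ) *
    Complex.I_mul_I

/-- The gaussian sums which dominate the theta series converge. -/
def GramSummable (h : V →ₗ[L ℓ] V →ₛₗ[conjL ℓ] L ℓ) (Λ : Submodule (𝓞 (L ℓ)) V) (n : ℕ) : Prop :=
  ∀ c : ℝ, 0 < c →
    Summable fun x : Fin n → Λ => Real.exp (-c * (gram h (fun i => (x i : V))).trace.re)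

variable [IsScalarTower (𝓞 (L ℓ)) (L ℓ) V] [Module.Finite (L ℓ) V] [Submodule.IsLattice (L ℓ) Λ]

theorem gramSummable (hℓ : IsNegFundamentalDiscriminant ℓ) (hh : IsPosDefHermitian h)
    (hΛ : hermDual h Λ = (fun v : V => sqrtNeg ℓ • v) '' (Λ : Set V)) (n : ℕ) :
    GramSummable h Λ n := by
  intro c hc
  obtain ⟨φ, hφ, hφs⟩ := exists_embedding hℓ hh
  obtain ⟨N, B, B', hB⟩ := exists_selfDual_bases hℓ hh hΛ hφ n
  let b := Basis.mk (linearIndependent_of_dual hB) (span_latticeCols hℓ hφs B).ge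
  refine (summable_gaussian_of_basis (B := B) (φ := latticeCols φ Λ n) (b := b)
    (fun i => by simp [b]) (half_pos hc)).congr fun x => ?_
  rw [norm_sq_latticeCols hφ]
  congr 1
  ring

/-- Writing `Y = pᴴ p`, the lattices under `p` and `qᴴ` are dual, `Y⁻¹ = (qᴴ)ᴴ qᴴ`, and the real
determinant of `p` on `d` columns is `(det Y)^d`. -/
theorem theta_I_smul_inv (hℓ : IsNegFundamentalDiscriminant ℓ) (hh : IsPosDefHermitian h)
    (hΛ : hermDual h Λ = (fun v : V => sqrtNeg ℓ • v) '' (Λ : Set V)) (n : ℕ)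
    {Y : Matrix (Fin n) (Fin n) ℂ} (hY : Y.PosDef) :
    theta h Λ n (Complex.I • Y⁻¹) = Y.det ^ finrank (L ℓ) V * theta h Λ n (Complex.I • Y) := by
  obtain ⟨φ, hφ, hφs⟩ := exists_embedding hℓ hh
  obtain ⟨N, B, B', hB⟩ := exists_selfDual_bases hℓ hh hΛ hφ n
  obtain ⟨p, q, hpq, rfl⟩ := exists_eq_conjTranspose_mul_self_of_posDef hY
  have hqp := mul_eq_one_comm.1 hpq
  have hpq' : qᴴ * pᴴ = 1 := by rw [← conjTranspose_mul, hpq, conjTranspose_one]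
  have h1 := tsum_gaussian_of_selfDual B B' (latticeCols φ Λ n) hB
    (span_latticeCols hℓ hφs B) (colsMul p q hpq _) (colsMul qᴴ pᴴ hpq' _)
    (inner_colsMul p q hpq)
  have hinv : (pᴴ * p)⁻¹ = qᴴᴴ * qᴴ := by
    rw [conjTranspose_conjTranspose]
    refine inv_eq_left_inv ?_
    rw [Matrix.mul_assoc, ← Matrix.mul_assoc qᴴ, hpq', Matrix.one_mul, hqp]
  have hdet : (pᴴ * p).det = (Complex.normSq p.det : ℂ) := by
    rw [det_mul, det_conjTranspose, Complex.normSq_eq_conj_mul_self]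
    rfl
  have hp0 : Complex.normSq p.det ≠ 0 := by
    have := congrArg Matrix.det hpq
    rw [det_mul, det_one] at this
    simpa using left_ne_zero_of_mul_eq_one this
  rw [det_colsMul, abs_of_nonneg (pow_nonneg (Complex.normSq_nonneg _) _)] at h1
  rw [hinv, hdet, theta, theta]
  simp only [thetaTerm_I_smul hφ qᴴ pᴴ hpq', thetaTerm_I_smul hφ p q hpq]
  rw [← Complex.ofReal_tsum, ← Complex.ofReal_tsum, h1]
  push_cast
  rw [mul_inv_cancel_left₀]
  exact pow_ne_zero _ (by exact_mod_cast hp0)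

end Theta

/-! ### Absolute convergence, boundedness and termwise differentiation. -/

section Analytic

variable {ℓ d n : ℕ} {V : Type*} [AddCommGroup V] [Module (L ℓ) V]
  {h : V →ₗ[L ℓ] V →ₛₗ[conjL ℓ] L ℓ}

theorem norm_thetaTerm_le (hh : IsPosDefHermitian h) {φ : V →ₗ[L ℓ] (Fin d → ℂ)}
    (hφ : ∀ x y, φ x ⬝ᵥ star (φ y) = 2 * (h x y : ℂ)) {ε : ℝ} {Z : Matrix (Fin n) (Fin n) ℂ}
    (hZ : (imPart Z - (ε : ℂ) • (1 : Matrix (Fin n) (Fin n) ℂ)).PosSemidef) (x : Fin n → V) :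
    ‖thetaTerm h Z x‖ ≤ Real.exp (-(2 * Real.pi * ε) * (gram h x).trace.re) := by
  rw [norm_thetaTerm, trace_gram_mul_imPart hh, Real.exp_le_exp]
  have h1 := re_trace_mul_nonneg (gram_posSemidef hφ x) hZ
  rw [Matrix.mul_sub, trace_sub, Matrix.mul_smul, Matrix.mul_one, trace_smul, Complex.sub_re,
    smul_eq_mul, Complex.re_ofReal_mul] at h1
  nlinarith [Real.pi_pos]

/-- The linear form `D ↦ trace (G D)`. -/
def traceMulCLM (G : Matrix (Fin n) (Fin n) ℂ) : (Fin n → Fin n → ℂ) →L[ℂ] ℂ :=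
  LinearMap.toContinuousLinearMap
    (((Matrix.traceLinearMap (Fin n) ℂ ℂ).comp (LinearMap.mulLeft ℂ G)).comp
      (Matrix.ofLinearEquiv ℂ).toLinearMap)

theorem traceMulCLM_apply (G : Matrix (Fin n) (Fin n) ℂ) (D : Fin n → Fin n → ℂ) :
    traceMulCLM G D = (G * Matrix.of D).trace := rfl

theorem norm_apply_apply_le (D : Fin n → Fin n → ℂ) (i j : Fin n) : ‖D i j‖ ≤ ‖D‖ :=
  (norm_le_pi_norm (D i) j).trans (norm_le_pi_norm D i)

theorem norm_traceMulCLM_le {G : Matrix (Fin n) (Fin n) ℂ} {T : ℝ} (hT : 0 ≤ T)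
    (hG : ∀ i j, ‖G i j‖ ≤ T) : ‖traceMulCLM G‖ ≤ n ^ 2 * T := by
  refine ContinuousLinearMap.opNorm_le_bound _ (by positivity) fun D => ?_
  rw [traceMulCLM_apply]
  refine (norm_trace_mul_le (D := Matrix.of D) hG (norm_apply_apply_le D)).trans_eq ?_
  rw [Fintype.card_fin]
  ring

theorem hasFDerivAt_thetaTerm (W : Fin n → Fin n → ℂ) (x : Fin n → V) :
    HasFDerivAt (fun W : Fin n → Fin n → ℂ => thetaTerm h (Matrix.of W) x)
      (thetaTerm h (Matrix.of W) x •
        ((2 * (Real.pi : ℂ) * Complex.I) • traceMulCLM (gram h x))) W :=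
  (((traceMulCLM (gram h x)).hasFDerivAt (x := W)).const_smul
    (2 * (Real.pi : ℂ) * Complex.I)).cexp

variable [Module (𝓞 (L ℓ)) V] {Λ : Submodule (𝓞 (L ℓ)) V}

theorem summable_thetaTerm (hs : GramSummable h Λ n) (hh : IsPosDefHermitian h)
    {φ : V →ₗ[L ℓ] (Fin d → ℂ)} (hφ : ∀ x y, φ x ⬝ᵥ star (φ y) = 2 * (h x y : ℂ))
    {Z : Matrix (Fin n) (Fin n) ℂ} (hZ : Z ∈ halfSpace n) :
    Summable fun x : Fin n → Λ => thetaTerm h Z (fun i => (x i : V)) := by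
  obtain ⟨ε, hε, hle⟩ := exists_pos_sub_smul_one_posSemidef (show (imPart Z).PosDef from hZ)
  exact (hs (2 * Real.pi * ε) (by positivity)).of_norm_bounded
    fun x => norm_thetaTerm_le hh hφ hle _

theorem norm_theta_le (hs : GramSummable h Λ n) (hh : IsPosDefHermitian h)
    {φ : V →ₗ[L ℓ] (Fin d → ℂ)} (hφ : ∀ x y, φ x ⬝ᵥ star (φ y) = 2 * (h x y : ℂ))
    {Y₀ : Matrix (Fin n) (Fin n) ℂ} (hY : Y₀.PosDef) :
    ∃ C : ℝ, ∀ Z : Matrix (Fin n) (Fin n) ℂ, (imPart Z - Y₀).PosSemidef → ‖theta h Λ n Z‖ ≤ C := by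
  obtain ⟨ε, hε, hle⟩ := exists_pos_sub_smul_one_posSemidef hY
  refine ⟨_, fun Z hZ => tsum_of_norm_bounded
    (hs (2 * Real.pi * ε) (by positivity)).hasSum fun x => norm_thetaTerm_le hh hφ ?_ _⟩
  simpa using hZ.add hle

/-- Termwise differentiation on a ball where all derivatives share one summable Gaussian majorant.
-/
theorem differentiableAt_theta_of (hs : GramSummable h Λ n) (hh : IsPosDefHermitian h)
    {φ : V →ₗ[L ℓ] (Fin d → ℂ)} (hφ : ∀ x y, φ x ⬝ᵥ star (φ y) = 2 * (h x y : ℂ))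
    {Z : Fin n → Fin n → ℂ} (hZ : Matrix.of Z ∈ halfSpace n) :
    DifferentiableAt ℂ (fun W : Fin n → Fin n → ℂ => theta h Λ n (Matrix.of W)) Z := by
  obtain ⟨ε, hε, hle⟩ := exists_pos_sub_smul_one_posSemidef (show (imPart (Matrix.of Z)).PosDef from hZ)
  -- An entrywise change of size `r` moves `trace(GZ)` by at most `n² r T ≤ εT/2`, with `T = trace
  -- G`, so half of the decay at the center survives. The `+ 1` covers `n = 0`.
  set r : ℝ := ε / (2 * (n ^ 2 + 1)) with hr
  have hr0 : 0 < r := by positivity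
  have hrn : (n : ℝ) ^ 2 * r ≤ ε / 2 := by
    rw [hr, ← mul_div_assoc, div_le_div_iff₀ (by positivity) two_pos]
    nlinarith
  have hT : ∀ x : Fin n → V, 0 ≤ (gram h x).trace.re := fun x =>
    (Complex.nonneg_iff.1 (gram_posSemidef hφ x).trace_nonneg).1
  have hbound : ∀ Z' ∈ Metric.ball Z r, ∀ x : Fin n → V,
      ‖thetaTerm h (Matrix.of Z') x‖ ≤ Real.exp (-(Real.pi * ε) * (gram h x).trace.re) := by
    intro Z' hZ' x
    have hZ'' : ‖Z' - Z‖ < r := by rwa [mem_ball_iff_norm] at hZ'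
    rw [norm_thetaTerm, Real.exp_le_exp]
    have h1 := re_trace_mul_nonneg (gram_posSemidef hφ x) hle
    rw [Matrix.mul_sub, trace_sub, Matrix.mul_smul, Matrix.mul_one, trace_smul, Complex.sub_re,
      smul_eq_mul, Complex.re_ofReal_mul, ← trace_gram_mul_imPart hh] at h1
    have h2 : ‖(gram h x * (Matrix.of Z' - Matrix.of Z)).trace‖ ≤ (n : ℝ) ^ 2 * r * (gram h x).trace.re := by
      have := norm_trace_mul_le (G := gram h x) (D := Matrix.of Z' - Matrix.of Z) (norm_gram_le hφ x)
        fun i j => (norm_apply_apply_le (Z' - Z) i j).trans hZ''.le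
      rwa [Fintype.card_fin] at this
    have h3 := (Complex.abs_im_le_norm _).trans h2
    rw [Matrix.mul_sub, trace_sub, Complex.sub_im] at h3
    have h4 := (abs_le.1 h3).1
    have h5 := mul_le_mul_of_nonneg_right hrn (hT x)
    nlinarith [Real.pi_pos]
  have hball : Z ∈ Metric.ball Z r := Metric.mem_ball_self hr0
  have hmain := hasFDerivAt_tsum_of_isPreconnected
    (f := fun (x : Fin n → Λ) (W : Fin n → Fin n → ℂ) => thetaTerm h (Matrix.of W) (fun i => (x i : V)))
    (u := fun x : Fin n → Λ => (2 * Real.pi * n ^ 2 * (2 / (Real.pi * ε))) *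
      Real.exp (-(Real.pi * ε / 2) * (gram h (fun i => (x i : V))).trace.re))
    ((hs (Real.pi * ε / 2) (by positivity)).mul_left _)
    Metric.isOpen_ball (convex_ball Z r).isPreconnected
    (fun x Z' _ => hasFDerivAt_thetaTerm Z' _) (fun x Z' hZ' => ?_) hball
    (summable_thetaTerm hs hh hφ hZ) hball
  · exact hmain.differentiableAt
  · set T := (gram h (fun i => (x i : V))).trace.re with hTd
    have hT0 : 0 ≤ T := hT _
    rw [norm_smul, norm_smul]
    have h1 := hbound Z' hZ' (fun i => (x i : V))
    have h2 := norm_traceMulCLM_le hT0 (norm_gram_le hφ (fun i => (x i : V)))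
    have h3 : ‖(2 * (Real.pi : ℂ) * Complex.I)‖ = 2 * Real.pi := by
      simp [abs_of_pos Real.pi_pos]
    -- The derivative contributes a factor `T`, absorbed by giving up half of the remaining
    -- exponential decay.
    have h4 : T ≤ 2 / (Real.pi * ε) * Real.exp (Real.pi * ε / 2 * T) := by
      have := Real.add_one_le_exp (Real.pi * ε / 2 * T)
      rw [div_mul_eq_mul_div, le_div_iff₀ (by positivity)]
      linarith
    rw [h3]
    calc _ ≤ Real.exp (-(Real.pi * ε) * T) * (2 * Real.pi * (n ^ 2 * T)) := by gcongr
      _ ≤ Real.exp (-(Real.pi * ε) * T) * (2 * Real.pi * (n ^ 2 *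
          (2 / (Real.pi * ε) * Real.exp (Real.pi * ε / 2 * T)))) := by gcongr
      _ = (2 * Real.pi * n ^ 2 * (2 / (Real.pi * ε))) *
          (Real.exp (-(Real.pi * ε) * T) * Real.exp (Real.pi * ε / 2 * T)) := by ring
      _ = _ := by
        rw [← Real.exp_add]
        congr 2
        ring

end Analytic

/-! ### Holomorphy in the matrix variable. -/

section Holomorphic

variable {ℓ d n : ℕ} {V : Type*} [AddCommGroup V] [Module (L ℓ) V]
  {h : V →ₗ[L ℓ] V →ₛₗ[conjL ℓ] L ℓ} [Module (𝓞 (L ℓ)) V] {Λ : Submodule (𝓞 (L ℓ)) V}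

theorem differentiableAt_theta (hs : GramSummable h Λ n) (hh : IsPosDefHermitian h)
    {φ : V →ₗ[L ℓ] (Fin d → ℂ)} (hφ : ∀ x y, φ x ⬝ᵥ star (φ y) = 2 * (h x y : ℂ))
    {Z : Matrix (Fin n) (Fin n) ℂ} (hZ : Z ∈ halfSpace n) :
    DifferentiableAt ℂ (theta h Λ n) Z :=
  differentiableAt_theta_of hs hh hφ hZ

end Holomorphic

/-! ### Stability properties of the Hermitian half space. -/

section HalfSpace

variable {n : ℕ}

/-- If `Zv = 0` then also `star v ⬝ᵥ (Zᴴ *ᵥ v) = 0`, so the imaginary part vanishes on `v`. -/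
theorem det_ne_zero_of_mem_halfSpace {Z : Matrix (Fin n) (Fin n) ℂ} (hZ : Z ∈ halfSpace n) :
    Z.det ≠ 0 := by
  intro h0
  obtain ⟨v, hv, hZv⟩ := exists_mulVec_eq_zero_iff.2 h0
  have h1 := (show (imPart Z).PosDef from hZ).dotProduct_mulVec_pos hv
  have h2 : star v ⬝ᵥ (Zᴴ *ᵥ v) = 0 := by
    rw [dotProduct_mulVec, ← star_mulVec, hZv]
    simp
  rw [imPart, smul_mulVec, sub_mulVec, hZv, zero_sub, smul_neg, dotProduct_neg, dotProduct_smul,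
    h2] at h1
  simp at h1

theorem mul_mul_mem_halfSpace {Z U : Matrix (Fin n) (Fin n) ℂ} (hZ : Z ∈ halfSpace n)
    (hU : IsUnit U) : Uᴴ * Z * U ∈ halfSpace n := by
  have h1 : imPart (Uᴴ * Z * U) = Uᴴ * imPart Z * U := by
    simp only [imPart, conjTranspose_mul, conjTranspose_conjTranspose, Matrix.mul_smul,
      Matrix.smul_mul, Matrix.mul_sub, Matrix.sub_mul, Matrix.mul_assoc]
  change (imPart _).PosDef
  rw [h1]
  exact (show (imPart Z).PosDef from hZ).conjTranspose_mul_mul_same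
    (mulVec_injective_iff_isUnit.2 hU)

/-- The imaginary part of `-Z⁻¹` is that of `Z` conjugated by `Z⁻¹`. -/
theorem neg_inv_mem_halfSpace {Z : Matrix (Fin n) (Fin n) ℂ} (hZ : Z ∈ halfSpace n) :
    -Z⁻¹ ∈ halfSpace n := by
  have hu : IsUnit Z.det := isUnit_iff_ne_zero.2 (det_ne_zero_of_mem_halfSpace hZ)
  have hu' : IsUnit Zᴴ.det := by rw [det_conjTranspose]; exact hu.star
  have h1 : imPart (-Z⁻¹) = (Z⁻¹)ᴴ * imPart Z * Z⁻¹ := by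
    rw [imPart, imPart, Matrix.mul_smul, Matrix.smul_mul, Matrix.mul_sub, Matrix.sub_mul,
      Matrix.mul_assoc, mul_nonsing_inv Z hu, Matrix.mul_one, conjTranspose_nonsing_inv,
      nonsing_inv_mul _ hu', Matrix.one_mul, conjTranspose_neg, conjTranspose_nonsing_inv]
    congr 1
    abel
  change (imPart _).PosDef
  rw [h1]
  exact (show (imPart Z).PosDef from hZ).conjTranspose_mul_mul_same
    (mulVec_injective_iff_isUnit.2 ((isUnit_nonsing_inv_iff).2 ((isUnit_iff_isUnit_det Z).2 hu)))

theorem imPart_add_of_isHermitian (Z : Matrix (Fin n) (Fin n) ℂ) {B : Matrix (Fin n) (Fin n) ℂ}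
    (hB : B.IsHermitian) : imPart (Z + B) = imPart Z := by
  rw [imPart, imPart, conjTranspose_add, hB.eq]
  congr 1
  abel

theorem imPart_smul_add_I_smul {X Y : Matrix (Fin n) (Fin n) ℂ} (hX : X.IsHermitian)
    (hY : Y.IsHermitian) (t : ℂ) : imPart (t • X + Complex.I • Y) = Y + (t.im : ℂ) • X := by
  ext i j
  have h1 := hX.apply i j
  have h2 := hY.apply i j
  simp only [imPart, Matrix.smul_apply, Matrix.sub_apply, Matrix.add_apply, conjTranspose_apply, smul_eq_mul, star_add,
    star_mul', h1, h2, RCLike.star_def, Complex.conj_I]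
  have h3 : t - starRingEnd ℂ t = 2 * t.im * Complex.I := by rw [Complex.sub_conj]; push_cast; ring
  field_simp
  linear_combination X i j * h3

theorem I_smul_mem_halfSpace {Y : Matrix (Fin n) (Fin n) ℂ} (hY : Y.PosDef) :
    Complex.I • Y ∈ halfSpace n := by
  have h1 := imPart_smul_add_I_smul (isHermitian_zero) hY.1 0
  rw [zero_smul, zero_add, smul_zero, add_zero] at h1
  change (imPart _).PosDef
  rwa [h1]

/-- Gives the width of the strip on which `tX + iY` stays in the half space: a perturbation smaller
than the spectral gap `ε` preserves positivity. -/
theorem exists_pos_forall_add_smul_posDef {X Y : Matrix (Fin n) (Fin n) ℂ} (hX : X.IsHermitian)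
    (hY : Y.PosDef) : ∃ δ : ℝ, 0 < δ ∧ ∀ s : ℝ, |s| < δ → (Y + (s : ℂ) • X).PosDef := by
  obtain ⟨ε, hε, hle⟩ := exists_pos_sub_smul_one_posSemidef hY
  set r : ℝ := ∑ i, ∑ j, ‖X i j‖ with hr
  have hr0 : 0 ≤ r := by positivity
  have hXr : ∀ i j, ‖X i j‖ ≤ r := fun i j =>
    (Finset.single_le_sum (f := fun j => ‖X i j‖) (fun _ _ => norm_nonneg _)
      (Finset.mem_univ j)).trans
    (Finset.single_le_sum (f := fun i => ∑ j, ‖X i j‖)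
      (fun _ _ => Finset.sum_nonneg fun _ _ => norm_nonneg _) (Finset.mem_univ i))
  refine ⟨ε / (n ^ 2 * r + 1), by positivity, fun s hs => ?_⟩
  have hsX : ((s : ℂ) • X).IsHermitian := by
    rw [IsHermitian, conjTranspose_smul, hX.eq]
    simp
  refine PosDef.of_dotProduct_mulVec_pos (hY.1.add hsX) fun v hv => ?_
  set q : ℝ := ∑ i, ‖v i‖ ^ 2 with hq
  have hq0 : 0 < q := by
    obtain ⟨i, hi⟩ := Function.ne_iff.1 hv
    exact Finset.sum_pos' (fun i _ => by positivity) ⟨i, Finset.mem_univ i, by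
      have : 0 < ‖v i‖ := norm_pos_iff.2 hi
      positivity⟩
  have hvv : star v ⬝ᵥ v = (q : ℂ) := by
    simp only [dotProduct, Pi.star_apply, RCLike.star_def, Complex.conj_mul', hq]
    push_cast
    rfl
  have hvq : ∀ i, ‖v i‖ ^ 2 ≤ q := fun i =>
    Finset.single_le_sum (f := fun i => ‖v i‖ ^ 2) (fun _ _ => by positivity) (Finset.mem_univ i)
  have hb : ‖star v ⬝ᵥ (X *ᵥ v)‖ ≤ n ^ 2 * r * q := by
    have h1 := norm_trace_mul_le (G := vecMulVec v (star v)) (D := X) (T := q) (fun i j => by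
      rw [vecMulVec_apply, norm_mul, Pi.star_apply, norm_star]
      nlinarith [hvq i, hvq j, sq_nonneg (‖v i‖ - ‖v j‖)]) hXr
    rw [Fintype.card_fin] at h1
    convert! h1 using 2
    rw [Matrix.trace_mul_comm, mul_vecMulVec, trace_vecMulVec, dotProduct_comm]
  have h2 := (Complex.nonneg_iff.1 (hle.dotProduct_mulVec_nonneg v)).1
  have h3 := (hY.1.add hsX)
  have himag : (star v ⬝ᵥ ((Y + (s : ℂ) • X) *ᵥ v)).im = 0 := h3.im_star_dotProduct_mulVec_self v
  rw [Complex.pos_iff]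
  refine ⟨?_, himag.symm⟩
  rw [sub_mulVec, smul_mulVec, one_mulVec, dotProduct_sub, dotProduct_smul, hvv, Complex.sub_re,
    smul_eq_mul, ← Complex.ofReal_mul, Complex.ofReal_re] at h2
  rw [add_mulVec, smul_mulVec, dotProduct_add, dotProduct_smul, smul_eq_mul, Complex.add_re,
    Complex.re_ofReal_mul]
  have h4 : |s * (star v ⬝ᵥ (X *ᵥ v)).re| < ε * q := by
    rw [abs_mul]
    have h5 := (Complex.abs_re_le_norm _).trans hb
    have h6 : |s| * (n ^ 2 * r + 1) < ε := (lt_div_iff₀ (by positivity)).1 hs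
    have h7 : |s| * |(star v ⬝ᵥ (X *ᵥ v)).re| ≤ |s| * (n ^ 2 * r * q) :=
      mul_le_mul_of_nonneg_left h5 (abs_nonneg s)
    nlinarith [abs_nonneg s]
  have h8 := (abs_lt.1 h4).1
  linarith

end HalfSpace

/-! ### Analytic continuation of the inversion formula. -/

section Continuation

variable {n : ℕ}

theorem differentiableAt_det {M : ℂ → Matrix (Fin n) (Fin n) ℂ} {t : ℂ}
    (hM : ∀ i j, DifferentiableAt ℂ (fun t => M t i j) t) :
    DifferentiableAt ℂ (fun t => (M t).det) t := by
  simp only [det_apply]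
  refine DifferentiableAt.fun_sum fun σ _ => ?_
  refine DifferentiableAt.const_smul (c := Equiv.Perm.sign σ) ?_
  exact DifferentiableAt.fun_finsetProd fun i _ => hM _ _

theorem differentiableAt_inv_apply {M : ℂ → Matrix (Fin n) (Fin n) ℂ} {t : ℂ}
    (hM : ∀ i j, DifferentiableAt ℂ (fun t => M t i j) t) (h0 : (M t).det ≠ 0) (i j : Fin n) :
    DifferentiableAt ℂ (fun t => (M t)⁻¹ i j) t := by
  simp only [inv_def, Ring.inverse_eq_inv', Matrix.smul_apply, smul_eq_mul, adjugate_apply]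
  refine ((differentiableAt_det hM).inv h0).mul (differentiableAt_det fun k l => ?_)
  simp only [updateRow_apply]
  by_cases hk : k = j
  · simp [hk]
  · simpa [hk] using hM k l

theorem differentiableAt_neg_apply {M : ℂ → Matrix (Fin n) (Fin n) ℂ} {t : ℂ}
    (hM : ∀ i j, DifferentiableAt ℂ (fun t => M t i j) t) (i j : Fin n) :
    DifferentiableAt ℂ (fun t => (-M t) i j) t := by
  simp only [Matrix.neg_apply]
  exact (hM i j).neg

theorem differentiableAt_smul_apply {M : ℂ → Matrix (Fin n) (Fin n) ℂ} {t : ℂ} (c : ℂ)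
    (hM : ∀ i j, DifferentiableAt ℂ (fun t => M t i j) t) (i j : Fin n) :
    DifferentiableAt ℂ (fun t => (c • M t) i j) t := by
  simp only [Matrix.smul_apply, smul_eq_mul]
  exact (hM i j).const_mul c

open Module

variable {ℓ d : ℕ} {V : Type*} [AddCommGroup V] [Module (L ℓ) V]
  {h : V →ₗ[L ℓ] V →ₛₗ[conjL ℓ] L ℓ} [Module (𝓞 (L ℓ)) V] {Λ : Submodule (𝓞 (L ℓ)) V}
  [IsScalarTower (𝓞 (L ℓ)) (L ℓ) V] [Module.Finite (L ℓ) V] [Submodule.IsLattice (L ℓ) Λ]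

omit [IsScalarTower (𝓞 (L ℓ)) (L ℓ) V] [Module.Finite (L ℓ) V] [Submodule.IsLattice (L ℓ) Λ] in
theorem differentiableAt_theta_comp {φ : V →ₗ[L ℓ] (Fin d → ℂ)}
    (hs : GramSummable h Λ n) (hh : IsPosDefHermitian h)
    (hφ : ∀ x y, φ x ⬝ᵥ star (φ y) = 2 * (h x y : ℂ)) {M : ℂ → Matrix (Fin n) (Fin n) ℂ} {t : ℂ}
    (ht : M t ∈ halfSpace n) (hM : ∀ i j, DifferentiableAt ℂ (fun t => M t i j) t) :
    DifferentiableAt ℂ (fun t => theta h Λ n (M t)) t := by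
  have h1 : DifferentiableAt ℂ (fun t => (fun i j => M t i j : Fin n → Fin n → ℂ)) t :=
    differentiableAt_pi.2 fun i => differentiableAt_pi.2 fun j => hM i j
  have h2 := differentiableAt_theta_of hs hh hφ ht
  exact h2.comp t h1

/-- For `Z = X + iY` the complex line `tX + iY` meets the known case `i(Y + sX)` at every small
imaginary `t = is` and reaches `Z` at `t = 1`. Both points lie in the strip where `|Im t|` is small,
so one-variable continuation is enough. -/
theorem theta_neg_inv (hℓ : IsNegFundamentalDiscriminant ℓ) (hh : IsPosDefHermitian h)
    (hΛ : hermDual h Λ = (fun v : V => sqrtNeg ℓ • v) '' (Λ : Set V))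
    {Z : Matrix (Fin n) (Fin n) ℂ} (hZ : Z ∈ halfSpace n) :
    theta h Λ n (-Z⁻¹) = ((Complex.I)⁻¹ • Z).det ^ finrank (L ℓ) V * theta h Λ n Z := by
  obtain ⟨φ, hφ, -⟩ := exists_embedding hℓ hh
  have hs := gramSummable hℓ hh hΛ n
  set Y := imPart Z with hY
  set X := (2⁻¹ : ℂ) • (Z + Zᴴ) with hX
  have hYp : Y.PosDef := hZ
  have hXh : X.IsHermitian := by
    rw [IsHermitian, hX, conjTranspose_smul, conjTranspose_add, conjTranspose_conjTranspose,
      add_comm]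
    simp
  have hZXY : Z = (1 : ℂ) • X + Complex.I • Y := by
    rw [hX, hY, imPart, one_smul, smul_smul]
    have : Complex.I * (2 * Complex.I)⁻¹ = 2⁻¹ := by field_simp
    rw [this, ← smul_add]
    ext i j
    simp
    ring
  clear_value X Y
  obtain ⟨δ, hδ, hpos⟩ := exists_pos_forall_add_smul_posDef hXh hYp
  set F : ℂ → Matrix (Fin n) (Fin n) ℂ := fun t => t • X + Complex.I • Y with hF
  set S : Set ℂ := {t | |t.im| < δ} with hS
  have hFS : ∀ t ∈ S, F t ∈ halfSpace n := by
    intro t ht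
    change (imPart _).PosDef
    rw [hF, imPart_smul_add_I_smul hXh hYp.1]
    exact hpos _ ht
  have hSo : IsOpen S := isOpen_lt (by fun_prop) continuous_const
  have hSc : IsPreconnected S := by
    have : S = Complex.imLm ⁻¹' Set.Ioo (-δ) δ := by
      ext t
      simp [hS, abs_lt]
    rw [this]
    exact ((convex_Ioo (-δ) δ).linear_preimage Complex.imLm).isPreconnected
  have hFd : ∀ t i j, DifferentiableAt ℂ (fun t => F t i j) t := by
    intro t i j
    simp only [hF, Matrix.add_apply, Matrix.smul_apply, smul_eq_mul]
    fun_prop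
  have hf1 : DifferentiableOn ℂ (fun t => theta h Λ n (-(F t)⁻¹)) S := fun t ht =>
    (differentiableAt_theta_comp (M := fun t => -(F t)⁻¹) hs hh hφ
      (neg_inv_mem_halfSpace (hFS t ht))
      (differentiableAt_neg_apply (differentiableAt_inv_apply (hFd t)
        (det_ne_zero_of_mem_halfSpace (hFS t ht))))).differentiableWithinAt
  have hf2 : DifferentiableOn ℂ (fun t => ((Complex.I)⁻¹ • F t).det ^ finrank (L ℓ) V *
      theta h Λ n (F t)) S := fun t ht =>
    (((differentiableAt_det (differentiableAt_smul_apply (Complex.I)⁻¹ (hFd t))).pow _).mul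
      (differentiableAt_theta_comp (M := F) hs hh hφ (hFS t ht)
        (hFd t))).differentiableWithinAt
  have h0S : (0 : ℂ) ∈ S := by simpa [hS] using hδ
  have heq : ∀ s : ℝ, |s| < δ → theta h Λ n (-(F (Complex.I * s))⁻¹) =
      ((Complex.I)⁻¹ • F (Complex.I * s)).det ^ finrank (L ℓ) V *
        theta h Λ n (F (Complex.I * s)) := by
    intro s hs'
    have h1 : F (Complex.I * s) = Complex.I • (Y + (s : ℂ) • X) := by
      rw [hF, smul_add, smul_smul, add_comm]
    have hp := hpos s hs'
    rw [h1, smul_smul Complex.I⁻¹, inv_mul_cancel₀ Complex.I_ne_zero, one_smul,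
      ← theta_I_smul_inv hℓ hh hΛ n hp]
    congr 1
    have hu : IsUnit (Y + (s : ℂ) • X).det := isUnit_iff_ne_zero.2 hp.det_pos.ne'
    refine neg_eq_iff_eq_neg.2 (inv_eq_left_inv ?_)
    rw [Matrix.neg_mul, Matrix.smul_mul, Matrix.mul_smul, nonsing_inv_mul _ hu, smul_smul,
      Complex.I_mul_I, neg_smul, one_smul, neg_neg]
  -- The nonzero points `is` accumulate at `0`, which is what the identity theorem requires.
  have hfreq : ∃ᶠ t in nhdsWithin (0 : ℂ) {0}ᶜ, theta h Λ n (-(F t)⁻¹) =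
      ((Complex.I)⁻¹ • F t).det ^ finrank (L ℓ) V * theta h Λ n (F t) := by
    have ht : Filter.Tendsto (fun s : ℝ => Complex.I * (s : ℂ)) (nhdsWithin 0 {0}ᶜ)
        (nhdsWithin 0 {0}ᶜ) := by
      refine tendsto_nhdsWithin_of_tendsto_nhds_of_eventually_within _ ?_ ?_
      · have : Continuous fun s : ℝ => Complex.I * (s : ℂ) := by fun_prop
        simpa using (this.tendsto 0).mono_left nhdsWithin_le_nhds
      · filter_upwards [self_mem_nhdsWithin] with s hs'
        simpa using hs'
    refine ht.frequently (Filter.Eventually.frequently ?_)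
    have h1 : ∀ᶠ s : ℝ in nhdsWithin 0 {0}ᶜ, |s| < δ :=
      Filter.Eventually.filter_mono nhdsWithin_le_nhds
        ((isOpen_lt continuous_abs continuous_const).mem_nhds (by simpa using hδ))
    filter_upwards [h1] with s hs' using heq s hs'
  have hmain := (hf1.analyticOnNhd hSo).eqOn_of_preconnected_of_frequently_eq
    (hf2.analyticOnNhd hSo) hSc h0S hfreq
  have h1S : (1 : ℂ) ∈ S := by simpa [hS] using hδ
  have := hmain h1S
  rw [hZXY]
  exact this

end Continuation

/-! ### Invariance under Hermitian translations and `GL_n(O_L)`. -/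

section Invariance

theorem sum_sum_mem_of_add_swap_mem {ι A : Type*} [AddCommMonoid A] (S : AddSubmonoid A)
    {f : ι → ι → A} (hdiag : ∀ i, f i i ∈ S) (hoff : ∀ i j, f i j + f j i ∈ S) (s : Finset ι) :
    ∑ i ∈ s, ∑ j ∈ s, f i j ∈ S := by
  classical
  induction s using Finset.induction_on with
  | empty => simp
  | insert a s ha ih =>
    have h1 : ∑ i ∈ insert a s, ∑ j ∈ insert a s, f i j =
        f a a + ∑ j ∈ s, (f a j + f j a) + ∑ i ∈ s, ∑ j ∈ s, f i j := by
      simp only [Finset.sum_insert ha, Finset.sum_add_distrib]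
      abel
    rw [h1]
    exact add_mem (add_mem (hdiag a) (sum_mem fun j _ => hoff a j)) ih

theorem exists_int_of_im_eq_zero {ℓ : ℕ} (α : 𝓞 (L ℓ)) (h : ((α : L ℓ) : ℂ).im = 0) :
    ∃ m : ℤ, ((α : L ℓ) : ℂ) = m := by
  obtain ⟨a, ha⟩ := exists_rat_re (α : L ℓ)
  have h1 : ((α : L ℓ) : ℂ) = (a : ℂ) := Complex.ext (by simpa using ha) (by simpa using h)
  have h2 := isIntegral_coe α
  rw [h1] at h2
  obtain ⟨m, hm⟩ := exists_int_of_isIntegral h2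
  exact ⟨m, by rw [h1, hm]; simp⟩

theorem toC_apply {ℓ n : ℕ} (A : Matrix (Fin n) (Fin n) (𝓞 (L ℓ))) (i j : Fin n) :
    toC A i j = ((A i j : L ℓ) : ℂ) := rfl

theorem toC_mul {ℓ n : ℕ} (A B : Matrix (Fin n) (Fin n) (𝓞 (L ℓ))) :
    toC (A * B) = toC A * toC B := Matrix.map_mul

theorem toC_one {ℓ n : ℕ} : toC (1 : Matrix (Fin n) (Fin n) (𝓞 (L ℓ))) = 1 :=
  Matrix.map_one _ (map_zero _) (map_one _)

theorem toC_neg {ℓ n : ℕ} (A : Matrix (Fin n) (Fin n) (𝓞 (L ℓ))) : toC (-A) = -toC A := by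
  ext i j
  simp [toC_apply]

theorem det_toC {ℓ n : ℕ} (A : Matrix (Fin n) (Fin n) (𝓞 (L ℓ))) :
    (toC A).det = ((A.det : L ℓ) : ℂ) :=
  (RingHom.map_det (algebraMap (𝓞 (L ℓ)) ℂ) A).symm

variable {ℓ n : ℕ} {V : Type*} [AddCommGroup V] [Module (L ℓ) V]
  {h : V →ₗ[L ℓ] V →ₛₗ[conjL ℓ] L ℓ} [Module (𝓞 (L ℓ)) V] {Λ : Submodule (𝓞 (L ℓ)) V}

/-- For odd `ℓ` a rational element of the inverse different is an integer. For `4 ∣ ℓ` it may be a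
half-integer, and evenness has to be assumed. -/
theorem exists_int_form_self (hℓ : IsNegFundamentalDiscriminant ℓ) (hh : IsPosDefHermitian h)
    (hΛ : hermDual h Λ = (fun v : V => sqrtNeg ℓ • v) '' (Λ : Set V))
    (heven : 4 ∣ ℓ → ∀ x ∈ Λ, ∃ m : ℤ, h x x = (m : L ℓ)) {x : V} (hx : x ∈ Λ) :
    ∃ m : ℤ, (h x x : ℂ) = m := by
  by_cases h4 : 4 ∣ ℓ
  · obtain ⟨m, hm⟩ := heven h4 x hx
    exact ⟨m, by rw [hm]; simp⟩
  · obtain ⟨α, hα⟩ := exists_sqrtNeg_mul_form hΛ hx hx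
    exact exists_int_of_sqrtNeg_mul_of_odd hℓ h4 hα (form_self_im hh x)

variable [IsScalarTower (𝓞 (L ℓ)) (L ℓ) V]

/-- Diagonal terms are products of two integers. The `(i, j)` and `(j, i)` terms are conjugate and
add up to the trace form at `(b x_i, x_j)`, with `b = B j i`. -/
theorem exists_int_trace_gram_mul (hℓ : IsNegFundamentalDiscriminant ℓ)
    (hh : IsPosDefHermitian h)
    (hΛ : hermDual h Λ = (fun v : V => sqrtNeg ℓ • v) '' (Λ : Set V))
    (heven : 4 ∣ ℓ → ∀ x ∈ Λ, ∃ m : ℤ, h x x = (m : L ℓ))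
    {B : Matrix (Fin n) (Fin n) (𝓞 (L ℓ))} (hB : (toC B).IsHermitian) (x : Fin n → Λ) :
    ∃ m : ℤ, (gram h (fun i => (x i : V)) * toC B).trace = m := by
  have key : ∑ i, ∑ j, gram h (fun i => (x i : V)) i j * toC B j i ∈
      (Int.castAddHom ℂ).range.toAddSubmonoid := by
    refine sum_sum_mem_of_add_swap_mem _ (fun i => ?_) (fun i j => ?_) _
    · obtain ⟨a, ha⟩ := exists_int_form_self hℓ hh hΛ heven (x i).2
      obtain ⟨b, hb⟩ := exists_int_of_im_eq_zero (B i i) (by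
        have := congrArg Complex.im (hB.apply i i)
        rw [RCLike.star_def, Complex.conj_im, toC_apply] at this
        linarith)
      refine ⟨a * b, ?_⟩
      change ((a * b : ℤ) : ℂ) = (h (x i) (x i) : ℂ) * ((B i i : L ℓ) : ℂ)
      rw [ha, hb]
      push_cast
      rfl
    · obtain ⟨m, hm⟩ := exists_int_two_mul_re_form hℓ hΛ (Λ.smul_mem (B j i) (x i).2) (x j).2
      refine ⟨m, ?_⟩
      have h1 : ((h (B j i • (x i : V)) (x j) : L ℓ) : ℂ) =
          gram h (fun i => (x i : V)) i j * toC B j i := by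
        rw [← coe_smul_eq, map_smul, LinearMap.smul_apply, smul_eq_mul, mul_comm]
        rfl
      have h2 : gram h (fun i => (x i : V)) j i * toC B i j =
          starRingEnd ℂ (gram h (fun i => (x i : V)) i j * toC B j i) := by
        rw [map_mul, ← hB.apply i j, ← (gram_isHermitian hh fun i => (x i : V)).apply j i]
        rfl
      rw [h2, Complex.add_conj, ← h1, hm]
      simp
  obtain ⟨m, hm⟩ := key
  exact ⟨m, by simpa [trace, mul_apply] using hm.symm⟩

theorem theta_add_toC (hℓ : IsNegFundamentalDiscriminant ℓ) (hh : IsPosDefHermitian h)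
    (hΛ : hermDual h Λ = (fun v : V => sqrtNeg ℓ • v) '' (Λ : Set V))
    (heven : 4 ∣ ℓ → ∀ x ∈ Λ, ∃ m : ℤ, h x x = (m : L ℓ))
    {B : Matrix (Fin n) (Fin n) (𝓞 (L ℓ))} (hB : (toC B).IsHermitian)
    (Z : Matrix (Fin n) (Fin n) ℂ) : theta h Λ n (Z + toC B) = theta h Λ n Z := by
  refine tsum_congr fun x => ?_
  obtain ⟨m, hm⟩ := exists_int_trace_gram_mul hℓ hh hΛ heven hB x
  rw [thetaTerm, thetaTerm, Matrix.mul_add, trace_add, hm, mul_add, Complex.exp_add,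
    mul_comm (2 * (Real.pi : ℂ) * Complex.I) (m : ℂ), Complex.exp_int_mul_two_pi_mul_I, mul_one]

/-- The action of `GL_n(O_L)` on `n`-tuples of lattice vectors. -/
def tupleEquiv (Λ : Submodule (𝓞 (L ℓ)) V) (U : GL (Fin n) (𝓞 (L ℓ))) :
    (Fin n → Λ) ≃ (Fin n → Λ) where
  toFun x i := ∑ j, (U : Matrix (Fin n) (Fin n) (𝓞 (L ℓ))) i j • x j
  invFun x i := ∑ j, ((U⁻¹ : GL (Fin n) (𝓞 (L ℓ))) : Matrix (Fin n) (Fin n) (𝓞 (L ℓ))) i j • x j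
  left_inv x := by
    have h1 : ((U⁻¹ : GL (Fin n) (𝓞 (L ℓ))) : Matrix (Fin n) (Fin n) (𝓞 (L ℓ))) * U = 1 :=
      Units.inv_mul U
    funext i
    simp only [Finset.smul_sum, smul_smul]
    rw [Finset.sum_comm]
    simp only [← Finset.sum_smul, ← mul_apply, h1, one_apply, ite_smul, one_smul, zero_smul,
      Finset.sum_ite_eq, Finset.mem_univ, if_true]
  right_inv x := by
    have h1 : (U : Matrix (Fin n) (Fin n) (𝓞 (L ℓ))) *
        ((U⁻¹ : GL (Fin n) (𝓞 (L ℓ))) : Matrix (Fin n) (Fin n) (𝓞 (L ℓ))) = 1 :=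
      Units.mul_inv U
    funext i
    simp only [Finset.smul_sum, smul_smul]
    rw [Finset.sum_comm]
    simp only [← Finset.sum_smul, ← mul_apply, h1, one_apply, ite_smul, one_smul, zero_smul,
      Finset.sum_ite_eq, Finset.mem_univ, if_true]

theorem gram_tupleEquiv (U : GL (Fin n) (𝓞 (L ℓ))) (x : Fin n → Λ) :
    gram h (fun i => (tupleEquiv Λ U x i : V)) =
      toC (U : Matrix (Fin n) (Fin n) (𝓞 (L ℓ))) * gram h (fun i => (x i : V)) *
        (toC (U : Matrix (Fin n) (Fin n) (𝓞 (L ℓ))))ᴴ := by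
  have h1 : ∀ i, (tupleEquiv Λ U x i : V) =
      ∑ j, ((U : Matrix (Fin n) (Fin n) (𝓞 (L ℓ))) i j : L ℓ) • (x j : V) := fun i => by
    simp [tupleEquiv]
  ext i j
  simp only [gram, of_apply, h1, mul_apply, conjTranspose_apply, toC_apply, map_sum, map_smul,
    LinearMap.sum_apply, LinearMap.smul_apply, LinearMap.map_smulₛₗ, smul_eq_mul,
    Finset.sum_mul]
  push_cast
  refine Finset.sum_congr rfl fun k _ => ?_
  simp only [coe_conjL, Finset.mul_sum]
  refine Finset.sum_congr rfl fun l _ => ?_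
  rw [RCLike.star_def]
  ring

/-- Reindexing the sum by `U` replaces `G` by `U G Uᴴ`, and the trace is cyclic. -/
theorem theta_conj_mul_mul (U : GL (Fin n) (𝓞 (L ℓ))) (Z : Matrix (Fin n) (Fin n) ℂ) :
    theta h Λ n ((toC (U : Matrix (Fin n) (Fin n) (𝓞 (L ℓ))))ᴴ * Z *
      toC (U : Matrix (Fin n) (Fin n) (𝓞 (L ℓ)))) = theta h Λ n Z := by
  rw [theta, theta, ← (tupleEquiv Λ U).tsum_eq fun x : Fin n → Λ => thetaTerm h Z fun i => (x i : V)]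
  refine tsum_congr fun x => ?_
  rw [thetaTerm, thetaTerm, gram_tupleEquiv]
  congr 2
  rw [← Matrix.mul_assoc, Matrix.trace_mul_comm]
  simp only [Matrix.mul_assoc]

end Invariance

/-! ### Divisibility of the rank by four. -/

section RankDivisible

open Module

variable {ℓ n d : ℕ} {V : Type*} [AddCommGroup V] [Module (L ℓ) V]
  {h : V →ₗ[L ℓ] V →ₛₗ[conjL ℓ] L ℓ} [Module (𝓞 (L ℓ)) V] {Λ : Submodule (𝓞 (L ℓ)) V}

theorem theta_I_ne_zero (hs : GramSummable h Λ n) (hh : IsPosDefHermitian h)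
    {φ : V →ₗ[L ℓ] (Fin d → ℂ)} (hφ : ∀ x y, φ x ⬝ᵥ star (φ y) = 2 * (h x y : ℂ)) :
    theta h Λ n (Complex.I • 1) ≠ 0 := by
  have hsum := summable_thetaTerm hs hh hφ (I_smul_mem_halfSpace (n := n) PosDef.one)
  have hval : ∀ x : Fin n → V, thetaTerm h (Complex.I • 1) x =
      (Real.exp (-(2 * Real.pi * (gram h x).trace.re)) : ℂ) := by
    intro x
    have h1 : ((gram h x).trace : ℂ) = ((gram h x).trace.re : ℂ) :=
      Complex.ext rfl (Complex.nonneg_iff.1 (gram_posSemidef hφ x).trace_nonneg).2.symm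
    rw [thetaTerm, Matrix.mul_smul, Matrix.mul_one, trace_smul, h1, smul_eq_mul]
    push_cast
    congr 1
    linear_combination (2 * Real.pi * (gram h x).trace.re : ℂ) * Complex.I_mul_I
  simp only [hval] at hsum
  have hsum' := Complex.summable_ofReal.1 hsum
  rw [theta]
  simp only [hval]
  rw [← Complex.ofReal_tsum]
  exact_mod_cast (hsum'.tsum_pos (fun _ => (Real.exp_pos _).le) 0 (Real.exp_pos _)).ne'

theorem four_dvd_of_neg_I_pow_eq_one {d : ℕ} (hd : (-Complex.I) ^ d = 1) : 4 ∣ d := by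
  have h4 : (-Complex.I) ^ 4 = 1 := by
    rw [Even.neg_pow (by decide)]
    exact Complex.I_pow_four
  rw [← Nat.div_add_mod d 4, pow_add, pow_mul, h4, one_pow, one_mul] at hd
  have hlt : d % 4 < 4 := Nat.mod_lt _ (by norm_num)
  refine Nat.dvd_of_mod_eq_zero ?_
  generalize d % 4 = k at hd hlt
  interval_cases k
  · rfl
  · have := congrArg Complex.re hd
    simp at this
  · have := congrArg Complex.re hd
    norm_num [pow_succ] at this
  · have := congrArg Complex.re hd
    simp [pow_succ] at this

variable [IsScalarTower (𝓞 (L ℓ)) (L ℓ) V] [Module.Finite (L ℓ) V] [Submodule.IsLattice (L ℓ) Λ]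

/-- Work in genus one, whatever `n` is. Moving `i ↦ i + 1 ↦ (1 + i)/2 ↦ i` by inversions and
translations gives `θ(i) = (-i)^d θ(i)`, and `θ(i)` is a sum of positive reals. -/
theorem four_dvd_finrank (hℓ : IsNegFundamentalDiscriminant ℓ) (hh : IsPosDefHermitian h)
    (hΛ : hermDual h Λ = (fun v : V => sqrtNeg ℓ • v) '' (Λ : Set V))
    (heven : 4 ∣ ℓ → ∀ x ∈ Λ, ∃ m : ℤ, h x x = (m : L ℓ)) : 4 ∣ finrank (L ℓ) V := by
  obtain ⟨φ, hφ, -⟩ := exists_embedding hℓ hh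
  have h0 := theta_I_ne_zero (gramSummable hℓ hh hΛ 1) hh hφ
  set t : ℂ → ℂ := fun z => theta h Λ 1 (z • 1) with ht
  have hT : ∀ z, t (z + 1) = t z := by
    intro z
    have := theta_add_toC hℓ hh hΛ heven (n := 1) (B := 1) (by rw [toC_one]; exact isHermitian_one)
      (z • 1)
    rw [toC_one] at this
    simpa only [ht, add_smul, one_smul] using this
  have hS : ∀ z : ℂ, 0 < z.im → t (-z⁻¹) = (Complex.I⁻¹ * z) ^ finrank (L ℓ) V * t z := by
    intro z hz
    have hz0 : z ≠ 0 := by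
      rintro rfl
      simp at hz
    have hmem : z • (1 : Matrix (Fin 1) (Fin 1) ℂ) ∈ halfSpace 1 := by
      have h1 : imPart (z • (1 : Matrix (Fin 1) (Fin 1) ℂ)) = ((z.im : ℝ) : ℂ) • 1 := by
        rw [imPart, conjTranspose_smul, conjTranspose_one, ← sub_smul, smul_smul,
          RCLike.star_def, Complex.sub_conj]
        congr 1
        field_simp
        push_cast
        ring
      change (imPart _).PosDef
      rw [h1]
      exact PosDef.one.smul (by exact_mod_cast hz)
    have h1 := theta_neg_inv hℓ hh hΛ hmem
    have h2 : -(z • (1 : Matrix (Fin 1) (Fin 1) ℂ))⁻¹ = (-z⁻¹) • 1 := by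
      rw [neg_smul]
      congr 1
      refine inv_eq_left_inv ?_
      rw [Matrix.smul_mul, Matrix.one_mul, smul_smul, inv_mul_cancel₀ hz0, one_smul]
    rw [h2, smul_smul, det_smul, det_one, Fintype.card_fin, pow_one, mul_one] at h1
    exact h1
  -- The two inversions take place at `z₁ = i + 1` and `z₂ = 1 - 1/z₁`; since `z₁ z₂ = i`, the
  -- automorphy factors multiply to `(i / i²)^d = (-i)^d`.
  have e1 := hS (Complex.I + 1) (by simp)
  have e2 := hS (-(Complex.I + 1)⁻¹ + 1) (by
    norm_num [Complex.inv_im, Complex.normSq_apply])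
  have hinv : (Complex.I + 1)⁻¹ = (1 - Complex.I) / 2 := by
    rw [inv_eq_iff_eq_inv, inv_div, eq_div_iff]
    · linear_combination -Complex.I_mul_I
    · exact fun hc => by simpa using congrArg Complex.re hc
  rw [hT, e1, hT, ← mul_assoc, ← mul_pow] at e2
  have hlast : -(-(Complex.I + 1)⁻¹ + 1)⁻¹ + 1 = Complex.I := by
    rw [hinv]
    have : -((1 - Complex.I) / 2) + 1 = (Complex.I + 1) / 2 := by ring
    rw [this, inv_div, div_eq_mul_inv, hinv]
    ring
  rw [← hT, hlast] at e2
  refine four_dvd_of_neg_I_pow_eq_one ?_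
  have hfac : Complex.I⁻¹ * (-(Complex.I + 1)⁻¹ + 1) * (Complex.I⁻¹ * (Complex.I + 1)) =
      -Complex.I := by
    rw [hinv, Complex.inv_I]
    linear_combination ((Complex.I ^ 2 + 2 * Complex.I) / 2) * Complex.I_mul_I
  rw [hfac] at e2
  exact (mul_eq_right₀ h0).1 e2.symm

end RankDivisible

/-! ### Automorphy factors and the full modular group. -/

section ModularGroup

variable {n : ℕ}

theorem denom_of_eq_fromBlocks {M : GL (Fin n ⊕ Fin n) ℂ} {A B C D : Matrix (Fin n) (Fin n) ℂ}
    (hM : (M : Matrix (Fin n ⊕ Fin n) (Fin n ⊕ Fin n) ℂ) = fromBlocks A B C D)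
    (Z : Matrix (Fin n) (Fin n) ℂ) : denom M Z = C * Z + D := by
  rw [denom, hM, toBlocks_fromBlocks₂₁, toBlocks_fromBlocks₂₂]

theorem act_of_eq_fromBlocks {M : GL (Fin n ⊕ Fin n) ℂ} {A B C D : Matrix (Fin n) (Fin n) ℂ}
    (hM : (M : Matrix (Fin n ⊕ Fin n) (Fin n ⊕ Fin n) ℂ) = fromBlocks A B C D)
    (Z : Matrix (Fin n) (Fin n) ℂ) : act M Z = (A * Z + B) * (C * Z + D)⁻¹ := by
  rw [act, denom_of_eq_fromBlocks hM, hM, toBlocks_fromBlocks₁₁, toBlocks_fromBlocks₁₂]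

theorem act_mul_denom (M : GL (Fin n ⊕ Fin n) ℂ) {Z : Matrix (Fin n) (Fin n) ℂ}
    (hZ : (denom M Z).det ≠ 0) :
    act M Z * denom M Z = (M : Matrix (Fin n ⊕ Fin n) (Fin n ⊕ Fin n) ℂ).toBlocks₁₁ * Z +
      (M : Matrix (Fin n ⊕ Fin n) (Fin n ⊕ Fin n) ℂ).toBlocks₁₂ := by
  rw [act, Matrix.mul_assoc, nonsing_inv_mul _ (isUnit_iff_ne_zero.2 hZ), Matrix.mul_one]

theorem coe_mul_eq_fromBlocks (M M' : GL (Fin n ⊕ Fin n) ℂ) :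
    ((M * M' : GL (Fin n ⊕ Fin n) ℂ) : Matrix (Fin n ⊕ Fin n) (Fin n ⊕ Fin n) ℂ) =
      fromBlocks (M.1.toBlocks₁₁ * M'.1.toBlocks₁₁ + M.1.toBlocks₁₂ * M'.1.toBlocks₂₁)
        (M.1.toBlocks₁₁ * M'.1.toBlocks₁₂ + M.1.toBlocks₁₂ * M'.1.toBlocks₂₂)
        (M.1.toBlocks₂₁ * M'.1.toBlocks₁₁ + M.1.toBlocks₂₂ * M'.1.toBlocks₂₁)
        (M.1.toBlocks₂₁ * M'.1.toBlocks₁₂ + M.1.toBlocks₂₂ * M'.1.toBlocks₂₂) := by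
  rw [← fromBlocks_multiply, fromBlocks_toBlocks, fromBlocks_toBlocks, Units.val_mul]

theorem denom_mul (M M' : GL (Fin n ⊕ Fin n) ℂ) {Z : Matrix (Fin n) (Fin n) ℂ}
    (hZ : (denom M' Z).det ≠ 0) : denom (M * M') Z = denom M (act M' Z) * denom M' Z := by
  rw [denom_of_eq_fromBlocks (coe_mul_eq_fromBlocks M M'), denom.eq_1 M, Matrix.add_mul _ _ (denom M' Z),
    Matrix.mul_assoc _ (act M' Z), act_mul_denom M' hZ, denom]
  simp only [Matrix.mul_add, Matrix.add_mul, Matrix.mul_assoc]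
  abel

theorem act_mul (M M' : GL (Fin n ⊕ Fin n) ℂ) {Z : Matrix (Fin n) (Fin n) ℂ}
    (hZ : (denom M' Z).det ≠ 0) : act (M * M') Z = act M (act M' Z) := by
  have hu : IsUnit (denom M' Z).det := isUnit_iff_ne_zero.2 hZ
  have h3 : ∀ W : Matrix (Fin n) (Fin n) ℂ, W * denom M' Z * (denom M' Z)⁻¹ = W := fun W => by
    rw [Matrix.mul_assoc, mul_nonsing_inv _ hu, Matrix.mul_one]
  rw [act_of_eq_fromBlocks (coe_mul_eq_fromBlocks M M'),
    ← denom_of_eq_fromBlocks (coe_mul_eq_fromBlocks M M'), denom_mul M M' hZ, Matrix.mul_inv_rev,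
    act.eq_1 M, ← Matrix.mul_assoc]
  congr 1
  rw [← h3 (_ * act M' Z + _), Matrix.add_mul _ _ (denom M' Z), Matrix.mul_assoc _ (act M' Z),
    act_mul_denom M' hZ, denom]
  congr 1
  simp only [Matrix.mul_add, Matrix.add_mul, Matrix.mul_assoc]
  abel

/-- `M` acts on the half space, and `f` transforms under `M` with weight `2 r` and character
`det ^ (-r)`. -/
def TransformsUnder (r : ℕ) (f : Matrix (Fin n) (Fin n) ℂ → ℂ) (M : GL (Fin n ⊕ Fin n) ℂ) :
    Prop :=
  ∀ Z ∈ halfSpace n, (denom M Z).det ≠ 0 ∧ act M Z ∈ halfSpace n ∧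
    f (act M Z) = ((M : Matrix (Fin n ⊕ Fin n) (Fin n ⊕ Fin n) ℂ).det ^ r)⁻¹ *
      (denom M Z).det ^ (2 * r) * f Z

variable {r : ℕ} {f : Matrix (Fin n) (Fin n) ℂ → ℂ}

theorem TransformsUnder.one : TransformsUnder r f 1 := by
  intro Z hZ
  have h1 : ((1 : GL (Fin n ⊕ Fin n) ℂ) : Matrix (Fin n ⊕ Fin n) (Fin n ⊕ Fin n) ℂ) =
      fromBlocks 1 0 0 1 := fromBlocks_one.symm
  rw [denom_of_eq_fromBlocks h1, act_of_eq_fromBlocks h1]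
  simpa using hZ

theorem TransformsUnder.mul {M M' : GL (Fin n ⊕ Fin n) ℂ} (hM : TransformsUnder r f M)
    (hM' : TransformsUnder r f M') : TransformsUnder r f (M * M') := by
  intro Z hZ
  obtain ⟨a1, a2, a3⟩ := hM' Z hZ
  obtain ⟨b1, b2, b3⟩ := hM _ a2
  rw [denom_mul M M' a1, act_mul M M' a1, det_mul]
  refine ⟨mul_ne_zero b1 a1, b2, ?_⟩
  rw [b3, a3, Units.val_mul, det_mul, mul_pow, mul_pow, mul_inv]
  ring

theorem val_inv_eq_of_mul_eq_one {M : GL (Fin n ⊕ Fin n) ℂ}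
    {N : Matrix (Fin n ⊕ Fin n) (Fin n ⊕ Fin n) ℂ}
    (hN : (M : Matrix (Fin n ⊕ Fin n) (Fin n ⊕ Fin n) ℂ) * N = 1) :
    ((M⁻¹ : GL (Fin n ⊕ Fin n) ℂ) : Matrix (Fin n ⊕ Fin n) (Fin n ⊕ Fin n) ℂ) = N := by
  rw [coe_units_inv]
  exact inv_eq_right_inv hN

variable {ℓ : ℕ}

/-- The transformation law composes by the cocycle relation, so it is enough to treat generators and
their inverses. Inverses of the first two kinds are again of that kind. -/
theorem transformsUnder_of_mem_fullModularGroup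
    (htrans : ∀ B : Matrix (Fin n) (Fin n) (𝓞 (L ℓ)), (toC B).IsHermitian →
      ∀ M : GL (Fin n ⊕ Fin n) ℂ,
        (M : Matrix (Fin n ⊕ Fin n) (Fin n ⊕ Fin n) ℂ) = fromBlocks 1 (toC B) 0 1 →
          TransformsUnder r f M)
    (hunit : ∀ (U : GL (Fin n) (𝓞 (L ℓ))) (M : GL (Fin n ⊕ Fin n) ℂ),
      (M : Matrix (Fin n ⊕ Fin n) (Fin n ⊕ Fin n) ℂ) =
        fromBlocks (toC (U : Matrix (Fin n) (Fin n) (𝓞 (L ℓ))))ᴴ 0 0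
          (toC ((U⁻¹ : GL (Fin n) (𝓞 (L ℓ))) : Matrix (Fin n) (Fin n) (𝓞 (L ℓ)))) →
        TransformsUnder r f M)
    (hinv : ∀ M : GL (Fin n ⊕ Fin n) ℂ,
      (M : Matrix (Fin n ⊕ Fin n) (Fin n ⊕ Fin n) ℂ) = fromBlocks 0 (-1) 1 0 →
        TransformsUnder r f M)
    {M : GL (Fin n ⊕ Fin n) ℂ} (hM : M ∈ fullModularGroup ℓ n) : TransformsUnder r f M := by
  induction hM using Subgroup.closure_induction_left with
  | one => exact TransformsUnder.one
  | mul_left M hM N _ hN =>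
    refine TransformsUnder.mul ?_ hN
    rcases hM with (⟨B, hB, hM⟩ | ⟨U, hM⟩) | hM
    exacts [htrans B hB M hM, hunit U M hM, hinv M hM]
  | inv_mul_cancel M hM N _ hN =>
    refine TransformsUnder.mul ?_ hN
    rcases hM with (⟨B, hB, hM⟩ | ⟨U, hM⟩) | hM
    · refine htrans (-B) (by rw [toC_neg]; exact hB.neg) _ (val_inv_eq_of_mul_eq_one ?_)
      rw [hM, toC_neg, fromBlocks_multiply, ← fromBlocks_one]
      congr 1 <;> simp
    · refine hunit U⁻¹ _ (val_inv_eq_of_mul_eq_one ?_)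
      rw [hM, fromBlocks_multiply, ← fromBlocks_one, ← conjTranspose_mul, ← toC_mul, ← toC_mul,
        ← Units.val_mul, ← Units.val_mul, mul_inv_cancel, inv_mul_cancel, Units.val_one, toC_one]
      congr 1 <;> simp
    -- The inversion matrix has order dividing four.
    · have h3 : M⁻¹ = M * M * M := by
        rw [inv_eq_iff_mul_eq_one]
        ext1
        rw [Units.val_mul, Units.val_mul, Units.val_mul, hM]
        simp only [fromBlocks_multiply, Units.val_one, ← fromBlocks_one]
        congr 1 <;> simp
      rw [h3]
      have := hinv M hM
      exact (this.mul this).mul this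

theorem toC_mul_toC_inv (U : GL (Fin n) (𝓞 (L ℓ))) :
    toC (U : Matrix (Fin n) (Fin n) (𝓞 (L ℓ))) *
      toC ((U⁻¹ : GL (Fin n) (𝓞 (L ℓ))) : Matrix (Fin n) (Fin n) (𝓞 (L ℓ))) = 1 := by
  rw [← toC_mul, ← Units.val_mul, mul_inv_cancel, Units.val_one, toC_one]

/-- `det U` is a unit of modulus one, so its conjugate equals its inverse `det U⁻¹`. -/
theorem det_eq_sq_of_eq_fromBlocks {U : GL (Fin n) (𝓞 (L ℓ))} {M : GL (Fin n ⊕ Fin n) ℂ}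
    (hM : (M : Matrix (Fin n ⊕ Fin n) (Fin n ⊕ Fin n) ℂ) =
      fromBlocks (toC (U : Matrix (Fin n) (Fin n) (𝓞 (L ℓ))))ᴴ 0 0
        (toC ((U⁻¹ : GL (Fin n) (𝓞 (L ℓ))) : Matrix (Fin n) (Fin n) (𝓞 (L ℓ))))) :
    (M : Matrix (Fin n ⊕ Fin n) (Fin n ⊕ Fin n) ℂ).det =
      (toC ((U⁻¹ : GL (Fin n) (𝓞 (L ℓ))) : Matrix (Fin n) (Fin n) (𝓞 (L ℓ)))).det ^ 2 := by
  rw [hM, det_fromBlocks_zero₂₁, det_conjTranspose, sq]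
  congr 1
  have h1 := congrArg Matrix.det (toC_mul_toC_inv U)
  rw [det_mul, det_one] at h1
  have h2 := Complex.mul_conj (toC (U : Matrix (Fin n) (Fin n) (𝓞 (L ℓ)))).det
  have h3 := normSq_unit (Matrix.GeneralLinearGroup.det U)
  rw [GeneralLinearGroup.val_det_apply, ← det_toC] at h3
  rw [h3, Complex.ofReal_one] at h2
  exact mul_left_cancel₀ (left_ne_zero_of_mul_eq_one h1) (h2.trans h1.symm)

/-- Squares suffice. On the block-diagonal generators the squared determinant is the fourth power of
a unit, and this is where `ℓ = 3` must be excluded. -/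
theorem det_pow_eq_one_of_mem_fullModularGroup (hℓ : IsNegFundamentalDiscriminant ℓ)
    (h3 : ℓ ≠ 3) {k : ℕ} {M : GL (Fin n ⊕ Fin n) ℂ} (hM : M ∈ fullModularGroup ℓ n) :
    (M : Matrix (Fin n ⊕ Fin n) (Fin n ⊕ Fin n) ℂ).det ^ (2 * k) = 1 := by
  rw [pow_mul]
  suffices h : (M : Matrix (Fin n ⊕ Fin n) (Fin n ⊕ Fin n) ℂ).det ^ 2 = 1 by rw [h, one_pow]
  induction hM using Subgroup.closure_induction with
  | mem M hM =>
    rcases hM with (⟨B, -, hM⟩ | ⟨U, hM⟩) | hM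
    · rw [hM, det_fromBlocks_zero₂₁]
      simp
    · rw [det_eq_sq_of_eq_fromBlocks hM, ← pow_mul, det_toC]
      exact unit_pow_four hℓ h3 (Matrix.GeneralLinearGroup.det U⁻¹)
    · rw [hM, sq]
      exact J_det_mul_J_det (Fin n) ℂ
  | one => simp
  | mul M N _ _ hM hN => rw [Units.val_mul, det_mul, mul_pow, hM, hN, one_mul]
  | inv M _ hM =>
    rw [coe_units_inv, det_nonsing_inv, Ring.inverse_eq_inv', inv_pow, hM, inv_one]

end ModularGroup

/-! ### The transformation law of the theta series. -/

section ThetaModular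

open Module

variable {ℓ n : ℕ} {V : Type*} [AddCommGroup V] [Module (L ℓ) V]
  {h : V →ₗ[L ℓ] V →ₛₗ[conjL ℓ] L ℓ} [Module (𝓞 (L ℓ)) V] {Λ : Submodule (𝓞 (L ℓ)) V}
  [IsScalarTower (𝓞 (L ℓ)) (L ℓ) V] [Module.Finite (L ℓ) V] [Submodule.IsLattice (L ℓ) Λ]

theorem transformsUnder_theta (hℓ : IsNegFundamentalDiscriminant ℓ) (hh : IsPosDefHermitian h)
    (hΛ : hermDual h Λ = (fun v : V => sqrtNeg ℓ • v) '' (Λ : Set V))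
    (heven : 4 ∣ ℓ → ∀ x ∈ Λ, ∃ m : ℤ, h x x = (m : L ℓ)) {k : ℕ} (hk : finrank (L ℓ) V = 4 * k)
    {M : GL (Fin n ⊕ Fin n) ℂ} (hM : M ∈ fullModularGroup ℓ n) :
    TransformsUnder (2 * k) (theta h Λ n) M := by
  refine transformsUnder_of_mem_fullModularGroup (fun B hB M hM Z hZ => ?_)
    (fun U M hM Z hZ => ?_) (fun M hM Z hZ => ?_) hM
  · rw [denom_of_eq_fromBlocks hM, act_of_eq_fromBlocks hM, hM, det_fromBlocks_zero₂₁]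
    simp only [Matrix.zero_mul, zero_add, inv_one, det_one, one_pow, one_mul, mul_one]
    refine ⟨one_ne_zero, ?_, theta_add_toC hℓ hh hΛ heven hB Z⟩
    change (imPart _).PosDef
    rw [imPart_add_of_isHermitian Z hB]
    exact hZ
  · have h1 := toC_mul_toC_inv U
    have h2 := congrArg Matrix.det h1
    rw [det_mul, det_one] at h2
    have h0 := right_ne_zero_of_mul_eq_one h2
    rw [denom_of_eq_fromBlocks hM, act_of_eq_fromBlocks hM, det_eq_sq_of_eq_fromBlocks hM]
    simp only [Matrix.zero_mul, zero_add, add_zero]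
    -- Here `det M` is the square of `det(CZ + D)`, so the character cancels the automorphy factor
    -- exactly, for every `ℓ`.
    rw [inv_eq_left_inv h1, theta_conj_mul_mul, ← pow_mul, inv_mul_cancel₀ (pow_ne_zero _ h0),
      one_mul]
    exact ⟨h0, mul_mul_mem_halfSpace hZ ((isUnit_iff_isUnit_det _).2
      (isUnit_iff_ne_zero.2 (left_ne_zero_of_mul_eq_one h2))), rfl⟩
  · have hdet : (M : Matrix (Fin n ⊕ Fin n) (Fin n ⊕ Fin n) ℂ).det ^ 2 = 1 := by
      rw [hM, sq]
      exact J_det_mul_J_det (Fin n) ℂ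
    rw [denom_of_eq_fromBlocks hM, act_of_eq_fromBlocks hM, pow_mul, hdet]
    simp only [Matrix.zero_mul, zero_add, add_zero, Matrix.neg_mul, one_pow,
      inv_one, one_mul]
    refine ⟨det_ne_zero_of_mem_halfSpace hZ, neg_inv_mem_halfSpace hZ, ?_⟩
    -- Divisibility of the rank by four turns `det(Z/i)^d` into `det(Z)^d`.
    have h4 : (Complex.I⁻¹) ^ (n * (4 * k)) = 1 := by
      rw [mul_left_comm, pow_mul, inv_pow, Complex.I_pow_four, inv_one, one_pow]
    rw [theta_neg_inv hℓ hh hΛ hZ, det_smul, mul_pow, hk, ← pow_mul, Fintype.card_fin, h4, one_mul,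
      show 4 * k = 2 * (2 * k) by ring]

end ThetaModular

end HermTheta

end

theorem mainTheorem2 (ℓ : ℕ) (hℓ : HermTheta.IsNegFundamentalDiscriminant ℓ)
    {V : Type*} [AddCommGroup V] [Module (HermTheta.L ℓ) V]
    [Module.Finite (HermTheta.L ℓ) V]
    [Module (𝓞 (HermTheta.L ℓ)) V] [IsScalarTower (𝓞 (HermTheta.L ℓ)) (HermTheta.L ℓ) V]
    (h : V →ₗ[HermTheta.L ℓ] V →ₛₗ[HermTheta.conjL ℓ] HermTheta.L ℓ)
    (hh : HermTheta.IsPosDefHermitian h)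
    (Λ : Submodule (𝓞 (HermTheta.L ℓ)) V) [Submodule.IsLattice (HermTheta.L ℓ) Λ]
    (hΛ : HermTheta.hermDual h Λ = (fun v : V => HermTheta.sqrtNeg ℓ • v) '' (Λ : Set V))
    (n : ℕ) (hn : 1 ≤ n) :
    (∀ Z ∈ HermTheta.halfSpace n,
      Summable (fun x : Fin n → Λ => HermTheta.thetaTerm h Z (fun i => (x i : V)))) ∧
    (∀ Z ∈ HermTheta.halfSpace n,
      HermTheta.theta h Λ n (-Z⁻¹) =
        ((Complex.I)⁻¹ • Z).det ^ Module.finrank (HermTheta.L ℓ) V *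
          HermTheta.theta h Λ n Z) ∧
    ((4 ∣ ℓ → ∀ x ∈ Λ, ∃ m : ℤ, h x x = (m : HermTheta.L ℓ)) →
      4 ∣ Module.finrank (HermTheta.L ℓ) V ∧
      HermTheta.IsHermitianModularForm ℓ n (Module.finrank (HermTheta.L ℓ) V / 2)
        (HermTheta.theta h Λ n) ∧
      (ℓ ≠ 3 → ∀ M ∈ HermTheta.fullModularGroup ℓ n, ∀ Z ∈ HermTheta.halfSpace n,
        HermTheta.theta h Λ n (HermTheta.act M Z) =
          (HermTheta.denom M Z).det ^ Module.finrank (HermTheta.L ℓ) V *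
            HermTheta.theta h Λ n Z)) := by
  obtain ⟨φ, hφ, -⟩ := HermTheta.exists_embedding hℓ hh
  have hs := HermTheta.gramSummable hℓ hh hΛ n
  refine ⟨fun Z hZ => HermTheta.summable_thetaTerm hs hh hφ hZ,
    fun Z hZ => HermTheta.theta_neg_inv hℓ hh hΛ hZ, fun heven => ?_⟩
  have h4 := HermTheta.four_dvd_finrank hℓ hh hΛ heven
  obtain ⟨k, hk⟩ := id h4
  have htr : ∀ M ∈ HermTheta.fullModularGroup ℓ n,
      HermTheta.TransformsUnder (2 * k) (HermTheta.theta h Λ n) M :=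
    fun M hM => HermTheta.transformsUnder_theta hℓ hh hΛ heven hk hM
  -- The halved weight is exact and even, so its power of `det M` is a power of `(det M)²`.
  have hk2 : Module.finrank (HermTheta.L ℓ) V / 2 = 2 * k := by omega
  refine ⟨h4, ⟨fun Z hZ =>
      (HermTheta.differentiableAt_theta hs hh hφ hZ).differentiableWithinAt, ?_,
      fun Y₀ hY₀ => HermTheta.norm_theta_le hs hh hφ hY₀⟩, ?_⟩
  · rw [hk2]
    exact fun M hM Z hZ => (htr M hM Z hZ).2.2
  · intro h3 M hM Z hZ
    have h5 := (htr M hM Z hZ).2.2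
    rw [HermTheta.det_pow_eq_one_of_mem_fullModularGroup hℓ h3 hM, inv_one, one_mul] at h5
    rw [h5, hk, show 4 * k = 2 * (2 * k) by ring]
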